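/- Let $(\rho_i)_{i\ge -1}$ be a dyadic partition of unity of $\mathbb{R}^d$: the functions $\rho_i:\mathbb{R}^d\to[0,1]$ are smooth, radial and compactly supported, $\operatorname{supp}\rho_{-1}\subset\{|x|<\frac43\}$, $\operatorname{supp}\rho_0\subset\{\frac34<|x|<\frac83\}$, $\rho_i(x)=\rho_0(2^{-i}x)$ for $i\ge0$, and $\sum_{i\ge-1}\rho_i=1$. For a tempered distribution $u$ on $\mathbb{R}^d$ set $\Delta_i u:=\mathscr{F}^{-1}(\rho_i\mathscr{F}u)$. For $\gamma\in\mathbb{R}$, let $\mathcal{C}^\gamma(\mathbb{R}^d)$ be the space of tempered distributions $u$ with $\sup_{i\ge-1}2^{\gamma i}\|\Delta_iu\|_{L^\infty}<\infty$. Write $$\mathsf{P}_uv:=\sum_{j}\ \sum_{i\le j-2}\Delta_iu\,\Delta_jv$$ for the paraproduct (as long as the series over $j$ converges in the space of tempered distributions), and, for $a,b\in L^\infty(\mathbb{R}^d)$, $$\mathsf{R}^\circ(a,b,c):=\mathsf{P}_a(\mathsf{P}_bc)-\mathsf{P}_{ab}c.$$ Let $\alpha>0$. Let $f\in L^\infty(\mathbb{R}^d)$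 and let $(a_n,b_n)_{1\le n\le N}$ be a finite family of elements of $L^\infty(\mathbb{R}^d)\times L^\infty(\mathbb{R}^d)$ such that, for all $x,y\in\mathbb{R}^d$, $$f(y)-f(x)=\sum_{n=1}^N a_n(x)\big(b_n(y)-b_n(x)\big)+f^\sharp_{yx},$$ where the remainder $f^\sharp$ satisfies $\sup_{x,y\in\mathbb{R}^d}|f^\sharp_{yx}|/|y-x|^\alpha<\infty$ (with $0/0:=0$). Then, for every $\beta\in\mathbb{R}$ and every $g\in\mathcal{C}^\beta(\mathbb{R}^d)$, the paraproducts in $\mathsf{R}^\circ(a_n,b_n,g)$, $1\le n\le N$, converge, and $$\sum_{n=1}^N\mathsf{R}^\circ(a_n,b_n,g)\in\mathcal{C}^{\alpha+\beta}(\mathbb{R}^d).$$ -/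

import Mathlib

open MeasureTheory TemperedDistribution
open scoped SchwartzMap FourierTransform ENNReal

noncomputable section

namespace Paracontrolled

/-- The space `ℝ^d` with its Euclidean norm and Lebesgue measure. -/
abbrev Rd (d : ℕ) : Type := EuclideanSpace ℝ (Fin d)

/-- A dyadic partition of unity `(ρ_i)_{i ≥ -1}` of `ℝ^d`. Indices are shifted by one, so that they
run over `ℕ`: `rho n` is `ρ_{n-1}`, and in particular `rho 0 = ρ_{-1}` and `rho 1 = ρ_0`. -/
structure DyadicPartition (d : ℕ) where
  /-- `rho n` is `ρ_{n-1}`. -/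
  rho : ℕ → Rd d → ℝ
  rho_mem_Icc : ∀ n x, rho n x ∈ Set.Icc (0 : ℝ) 1
  hasCompactSupport_rho : ∀ n, HasCompactSupport (rho n)
  contDiff_rho : ∀ n, ContDiff ℝ ((⊤ : ℕ∞) : WithTop ℕ∞) (rho n)
  radial : ∀ n x y, ‖x‖ = ‖y‖ → rho n x = rho n y
  tsupport_rho_zero : tsupport (rho 0) ⊆ {x | ‖x‖ < 4 / 3}
  tsupport_rho_one : tsupport (rho 1) ⊆ {x | 3 / 4 < ‖x‖ ∧ ‖x‖ < 8 / 3}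
  rho_scaling : ∀ (n : ℕ) x, rho (n + 1) x = rho 1 (((2 : ℝ) ^ n)⁻¹ • x)
  hasSum_rho : ∀ x, HasSum (fun n => rho n x) 1

variable {d : ℕ}

namespace DyadicPartition

variable (D : DyadicPartition d)

/-- The Littlewood-Paley block `Δ_{n-1} u = 𝓕⁻¹ (ρ_{n-1} 𝓕 u)` of a tempered distribution `u`. -/
def block (n : ℕ) : 𝓢'(Rd d, ℂ) →L[ℂ] 𝓢'(Rd d, ℂ) :=
  fourierMultiplierCLM ℂ (fun x => (D.rho n x : ℂ))

theorem hasCompactSupport_ofReal_rho (n : ℕ) :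
    HasCompactSupport (fun x => (D.rho n x : ℂ)) :=
  (D.hasCompactSupport_rho n).comp_left (g := fun t : ℝ => (t : ℂ)) Complex.ofReal_zero

theorem contDiff_ofReal_rho (n : ℕ) : ContDiff ℝ ((⊤ : ℕ∞) : WithTop ℕ∞) (fun x => (D.rho n x : ℂ)) :=
  Complex.ofRealCLM.contDiff.comp (D.contDiff_rho n)

/-- The function `ρ_{n-1}` as a Schwartz function. -/
def rhoSchwartz (n : ℕ) : 𝓢(Rd d, ℂ) :=
  (D.hasCompactSupport_ofReal_rho n).toSchwartzMap (D.contDiff_ofReal_rho n)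

/-- The kernel `Q_{n-1} = 𝓕⁻¹ ρ_{n-1}` of the Littlewood-Paley block `Δ_{n-1}`. -/
def kernel (n : ℕ) : 𝓢(Rd d, ℂ) := 𝓕⁻ (D.rhoSchwartz n)

/-- The Schwartz function `y ↦ Q_{n-1}(x - y)`. -/
def kernelAt (n : ℕ) (x : Rd d) : 𝓢(Rd d, ℂ) :=
  SchwartzMap.compSubConstCLM ℂ x
    (SchwartzMap.compCLMOfContinuousLinearEquiv ℂ (ContinuousLinearEquiv.neg ℝ) (D.kernel n))

theorem kernelAt_apply (n : ℕ) (x y : Rd d) : D.kernelAt n x y = D.kernel n (x - y) := by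
  simp [kernelAt]

/-- The smooth function `x ↦ (Δ_{n-1} u)(x) = ⟨u, Q_{n-1}(x - ·)⟩`. -/
def blockFun (n : ℕ) (u : 𝓢'(Rd d, ℂ)) (x : Rd d) : ℂ := u (D.kernelAt n x)

end DyadicPartition

/-- The `L^∞` norm of a tempered distribution: the norm of the function in `L^∞` that represents it,
and `∞` if there is none. -/
def linftyNorm (u : 𝓢'(Rd d, ℂ)) : ℝ≥0∞ :=
  ⨅ (h : Lp ℂ ∞ (volume : Measure (Rd d))) (_ : (h : 𝓢'(Rd d, ℂ)) = u), ‖h‖ₑ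

namespace DyadicPartition

variable (D : DyadicPartition d)

/-- The Hölder-Besov norm `sup_{i ≥ -1} 2^{γ i} ‖Δ_i u‖_{L^∞}`, with `i = n - 1`. -/
def holderNorm (γ : ℝ) (u : 𝓢'(Rd d, ℂ)) : ℝ≥0∞ :=
  ⨆ n : ℕ, ENNReal.ofReal ((2 : ℝ) ^ (γ * ((n : ℝ) - 1))) * linftyNorm (D.block n u)

/-- The tempered distribution `u` belongs to `C^γ(ℝ^d) = B^γ_{∞,∞}(ℝ^d)`. -/
def MemHolder (γ : ℝ) (u : 𝓢'(Rd d, ℂ)) : Prop := D.holderNorm γ u < ∞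

/-- The term `∑_{i ≤ j - 2} Δ_i u Δ_j v` of the paraproduct, with `j = n - 1` and `i = m - 1`. Here
`Δ_i u` is a smooth function of temperate growth, which multiplies the distribution `Δ_j v`. -/
def paraTerm (u v : 𝓢'(Rd d, ℂ)) (n : ℕ) : 𝓢'(Rd d, ℂ) :=
  ∑ m ∈ Finset.range (n - 1), smulLeftCLM ℂ (D.blockFun m u) (D.block n v)

/-- The series that defines the paraproduct `P_u v` converges (in the space of tempered
distributions). -/
def ParaConverges (u v : 𝓢'(Rd d, ℂ)) : Prop := Summable (D.paraTerm u v)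

/-- Bony's paraproduct `P_u v = ∑_{i ≤ j - 2} Δ_i u Δ_j v`. -/
def para (u v : 𝓢'(Rd d, ℂ)) : 𝓢'(Rd d, ℂ) := ∑' n, D.paraTerm u v n

end DyadicPartition

/-- The tempered distribution defined by an essentially bounded function. -/
def distOf (f : Rd d → ℂ) (hf : MemLp f ∞ volume) : 𝓢'(Rd d, ℂ) :=
  ((hf.toLp f : Lp ℂ ∞ (volume : Measure (Rd d))) : 𝓢'(Rd d, ℂ))

theorem memLp_top_mul {a b : Rd d → ℂ} (ha : MemLp a ∞ volume) (hb : MemLp b ∞ volume) :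
    MemLp (fun x => a x * b x) ∞ volume :=
  hb.mul (r := ∞) ha

namespace DyadicPartition

variable (D : DyadicPartition d)

/-- The operator `R°(a, b, v) = P_a (P_b v) - P_{ab} v`, for `a, b` in `L^∞`. -/
def Rcirc (a b : Rd d → ℂ) (ha : MemLp a ∞ volume) (hb : MemLp b ∞ volume)
    (v : 𝓢'(Rd d, ℂ)) : 𝓢'(Rd d, ℂ) :=
  D.para (distOf a ha) (D.para (distOf b hb) v)
    - D.para (distOf (fun x => a x * b x) (memLp_top_mul ha hb)) v

/-- The three paraproducts in `R°(a, b, v)` converge. -/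
def RcircConverges (a b : Rd d → ℂ) (ha : MemLp a ∞ volume) (hb : MemLp b ∞ volume)
    (v : 𝓢'(Rd d, ℂ)) : Prop :=
  D.ParaConverges (distOf b hb) v
    ∧ D.ParaConverges (distOf a ha) (D.para (distOf b hb) v)
    ∧ D.ParaConverges (distOf (fun x => a x * b x) (memLp_top_mul ha hb)) v

end DyadicPartition

/-- The two-parameter Hölder norm `sup_{y,z} |F(y,z)| / |y-z|^α`. In `[0, ∞]` one has `0 / 0 = 0` and
`c / 0 = ∞` for `c ≠ 0`, so that it is infinite unless `F` vanishes on the diagonal. -/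
def twoParamHolderNorm (α : ℝ) (F : Rd d → Rd d → ℂ) : ℝ≥0∞ :=
  ⨆ (y : Rd d) (z : Rd d), ‖F y z‖ₑ / ‖y - z‖ₑ ^ α

end Paracontrolled

end

/-! Write S_k for the low-frequency projection in the k-th paraproduct term (`lowKernel`). Adding
and subtracting P_f g turns the sum of the R°(a_n, b_n, g) into a series over k with terms Σ_n S_k
a_n · Δ_k P_{b_n} g − Σ_n S_k(a_n b_n) · Δ_k g − Δ_k P_f g + S_k f · Δ_k g. By spectral
localization, Δ_k P_b g is the sum of Δ_k(S_j b · Δ_j g) over j close to k, and Δ_k g is likewise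
the sum of Δ_k Δ_j g. For each such j, with K₁, K₂, K₃ the kernels of S_k, Δ_k, S_j, the
contribution at x is exactly −∫∫∫ K₁(x−y) K₂(x−z) K₃(z−w) f♯_{wy} (Δ_j g)(z) dw dz dy, because K₁
and K₃ have integral 1. All three kernels live at scale 2^{-k}, so |f♯_{wy}| ≲ |w−y|^α gains 2^{-kα}
on top of the factor 2^{-kβ} from Δ_j g. This is `norm_average_remainder_le`, used in
`exists_rep_remainder`.

Applying Δ_m leaves only the terms with |k − m| ≤ 4, so no sign condition on α + β is needed. The
paraproducts converge for the same spectral reason: the k-th term lives at frequency about 2^k, and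
testing it against a Schwartz function gains an arbitrary power of 2^{-k}
(`exists_norm_block_apply_le`). -/

noncomputable section

namespace Paracontrolled

variable {d : ℕ}

/-! ### Convolution of a bounded function with a Schwartz function -/

/-- The function `F` is almost everywhere strongly measurable and essentially bounded by `C`. -/
structure EssBdd (F : Rd d → ℂ) (C : ℝ) : Prop where
  aesm : AEStronglyMeasurable F volume
  bound : ∀ᵐ x, ‖F x‖ ≤ C

theorem EssBdd.nonneg {F : Rd d → ℂ} {C : ℝ} (hF : EssBdd F C) : 0 ≤ C := by
  obtain ⟨x, hx⟩ := hF.bound.exists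
  exact (norm_nonneg _).trans hx

theorem EssBdd.mono {F : Rd d → ℂ} {C C' : ℝ} (hF : EssBdd F C) (h : C ≤ C') : EssBdd F C' :=
  ⟨hF.aesm, hF.bound.mono fun _ hx => hx.trans h⟩

theorem EssBdd.add {F G : Rd d → ℂ} {C C' : ℝ} (hF : EssBdd F C) (hG : EssBdd G C') :
    EssBdd (fun x => F x + G x) (C + C') :=
  ⟨hF.aesm.add hG.aesm, by
    filter_upwards [hF.bound, hG.bound] with x h1 h2 using (norm_add_le _ _).trans (add_le_add h1 h2)⟩

theorem EssBdd.sub {F G : Rd d → ℂ} {C C' : ℝ} (hF : EssBdd F C) (hG : EssBdd G C') :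
    EssBdd (fun x => F x - G x) (C + C') :=
  ⟨hF.aesm.sub hG.aesm, by
    filter_upwards [hF.bound, hG.bound] with x h1 h2 using (norm_sub_le _ _).trans (add_le_add h1 h2)⟩

theorem EssBdd.mul {F G : Rd d → ℂ} {C C' : ℝ} (hF : EssBdd F C) (hG : EssBdd G C') :
    EssBdd (fun x => F x * G x) (C * C') :=
  ⟨hF.aesm.mul hG.aesm, by
    filter_upwards [hF.bound, hG.bound] with x h1 h2
    rw [norm_mul]
    exact mul_le_mul h1 h2 (norm_nonneg _) ((norm_nonneg _).trans h1)⟩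

theorem essBdd_const (c : ℂ) : EssBdd (fun _ : Rd d => c) ‖c‖ :=
  ⟨aestronglyMeasurable_const, by simp⟩

theorem EssBdd.const_mul {F : Rd d → ℂ} {C : ℝ} (hF : EssBdd F C) (c : ℂ) :
    EssBdd (fun x => c * F x) (‖c‖ * C) :=
  (essBdd_const c).mul hF

theorem EssBdd.sum {ι : Type*} (s : Finset ι) {F : ι → Rd d → ℂ} {C : ι → ℝ}
    (hF : ∀ i ∈ s, EssBdd (F i) (C i)) :
    EssBdd (fun x => ∑ i ∈ s, F i x) (∑ i ∈ s, C i) := by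
  classical
  induction s using Finset.induction_on with
  | empty => simpa using essBdd_const (d := d) 0
  | insert i s his ih =>
    simp only [Finset.sum_insert his]
    exact (hF i (Finset.mem_insert_self i s)).add
      (ih fun j hj => hF j (Finset.mem_insert_of_mem hj))

/-- The convolution `x ↦ ∫ F(y) K(x - y) dy`. -/
def conv {V : Type*} [NormedAddCommGroup V] [NormedSpace ℂ V] (K : 𝓢(Rd d, V)) (F : Rd d → ℂ)
    (x : Rd d) : V :=
  ∫ y, F y • K (x - y)

section Conv

variable {V : Type*} [NormedAddCommGroup V] [NormedSpace ℂ V]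

theorem integrable_conv {F : Rd d → ℂ} {C : ℝ} (hF : EssBdd F C) (K : 𝓢(Rd d, V)) (x : Rd d) :
    Integrable (fun y => F y • K (x - y)) := by
  have hK : Integrable (fun y => K (x - y)) := K.integrable.comp_sub_left x
  refine (hK.norm.const_mul C).mono' (hF.aesm.smul hK.aestronglyMeasurable) ?_
  filter_upwards [hF.bound] with y hy
  rw [norm_smul]
  gcongr

theorem norm_conv_le {F : Rd d → ℂ} {C : ℝ} (hF : EssBdd F C) (K : 𝓢(Rd d, V)) (x : Rd d) :
    ‖conv K F x‖ ≤ (∫ y, ‖K y‖) * C := by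
  have hK : Integrable (fun y => K (x - y)) := K.integrable.comp_sub_left x
  refine (norm_integral_le_of_norm_le (hK.norm.const_mul C) ?_).trans ?_
  · filter_upwards [hF.bound] with y hy
    rw [norm_smul]
    gcongr
  · rw [integral_const_mul, mul_comm, integral_sub_left_eq_self (fun y => ‖K y‖) volume x]

theorem exists_norm_le_rpow_neg (K : 𝓢(Rd d, V)) (r : ℕ) :
    ∃ C : ℝ, 0 ≤ C ∧ ∀ z, ‖K z‖ ≤ C * (1 + ‖z‖) ^ (-(r : ℝ)) := by
  refine ⟨2 ^ r * ((Finset.Iic (r, 0)).sup fun m => SchwartzMap.seminorm ℝ m.1 m.2) K,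
    by positivity, fun z => ?_⟩
  have h := SchwartzMap.one_add_le_sup_seminorm_apply (𝕜 := ℝ) (m := (r, 0)) le_rfl le_rfl K z
  rw [norm_iteratedFDeriv_zero] at h
  rw [Real.rpow_neg (by positivity), Real.rpow_natCast, ← div_eq_mul_inv,
    le_div_iff₀ (by positivity), mul_comm]
  exact h

theorem hasFDerivAt_conv {F : Rd d → ℂ} {C : ℝ} (hF : EssBdd F C) (K : 𝓢(Rd d, V)) (x : Rd d) :
    HasFDerivAt (conv K F) (conv (SchwartzMap.fderivCLM ℂ (Rd d) V K) F x) x := by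
  set K' := SchwartzMap.fderivCLM ℂ (Rd d) V K with hK'
  obtain ⟨B, hB0, hB⟩ := exists_norm_le_rpow_neg K' (Module.finrank ℝ (Rd d) + 1)
  set r : ℝ := ((Module.finrank ℝ (Rd d) + 1 : ℕ) : ℝ) with hr
  have h_int : Integrable (fun z : Rd d => (1 + ‖z‖) ^ (-r)) :=
    integrable_one_add_norm (by rw [hr]; push_cast; linarith)
  refine hasFDerivAt_integral_of_dominated_of_fderiv_le (𝕜 := ℝ)
    (bound := fun y => C * (B * (2 ^ r * (1 + ‖x - y‖) ^ (-r))))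
    (s := Metric.ball x 1)
    (F' := fun x' y => F y • K' (x' - y)) (Metric.ball_mem_nhds x one_pos) ?_
    (integrable_conv hF K x) (integrable_conv hF K' x).aestronglyMeasurable ?_ ?_ ?_
  · exact Filter.Eventually.of_forall fun x' => (integrable_conv hF K x').aestronglyMeasurable
  · filter_upwards [hF.bound] with y hy x' hx'
    rw [norm_smul]
    have hC := hF.nonneg
    gcongr
    refine (hB _).trans ?_
    gcongr
    rw [Metric.mem_ball, dist_eq_norm] at hx'
    -- Moving x' within the unit ball around x changes the weight by a factor at most 2, so the
    -- dominating function can be taken independent of x'.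
    have h1 : 1 + ‖x - y‖ ≤ 2 * (1 + ‖x' - y‖) := by
      have : ‖x - y‖ ≤ ‖x' - x‖ + ‖x' - y‖ := by
        rw [← norm_neg (x' - x)]
        simpa using norm_add_le (-(x' - x)) (x' - y)
      linarith [norm_nonneg (x' - y)]
    have hr0 : 0 ≤ r := by rw [hr]; positivity
    rw [Real.rpow_neg (by positivity), Real.rpow_neg (by positivity), ← div_eq_mul_inv,
      le_div_iff₀ (by positivity), inv_mul_le_iff₀ (by positivity), mul_comm,
      ← Real.mul_rpow (by positivity) (by positivity)]
    exact Real.rpow_le_rpow (by positivity) h1 hr0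
  · exact ((h_int.comp_sub_left x).const_mul _).const_mul _ |>.const_mul _
  · refine Filter.Eventually.of_forall fun y x' _ => ?_
    have h1 : HasFDerivAt (fun x' : Rd d => K (x' - y)) (K' (x' - y)) x' := by
      have := (K.hasFDerivAt (x' - y)).comp x' ((hasFDerivAt_id x').sub_const y)
      simpa [hK', Function.comp_def] using this
    exact h1.const_smul (F y)

end Conv

/-- Derivatives fall on the kernel, and the derivative is again a convolution, with a kernel valued
in linear maps. Hence V is quantified inside the induction. -/
theorem contDiff_conv_and_bound {F : Rd d → ℂ} {C : ℝ} (hF : EssBdd F C) (n : ℕ) :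
    ∀ {V : Type} [NormedAddCommGroup V] [NormedSpace ℂ V] (K : 𝓢(Rd d, V)),
      ContDiff ℝ n (conv K F) ∧ ∃ B : ℝ, ∀ x, ‖iteratedFDeriv ℝ n (conv K F) x‖ ≤ B := by
  induction n with
  | zero =>
    intro V _ _ K
    refine ⟨?_, (∫ y, ‖K y‖) * C, fun x => ?_⟩
    · rw [Nat.cast_zero, contDiff_zero]
      exact continuous_iff_continuousAt.2 fun x => (hasFDerivAt_conv hF K x).continuousAt
    · rw [norm_iteratedFDeriv_zero]
      exact norm_conv_le hF K x
  | succ n ih =>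
    intro V _ _ K
    have hfd : fderiv ℝ (conv K F) = conv (SchwartzMap.fderivCLM ℂ (Rd d) V K) F :=
      funext fun x => (hasFDerivAt_conv hF K x).fderiv
    obtain ⟨h1, B, hB⟩ := ih (SchwartzMap.fderivCLM ℂ (Rd d) V K)
    refine ⟨?_, B, fun x => ?_⟩
    · push_cast
      rw [contDiff_succ_iff_fderiv]
      exact ⟨fun x => (hasFDerivAt_conv hF K x).differentiableAt, by simp, hfd ▸ h1⟩
    · rw [← norm_iteratedFDeriv_fderiv, hfd]
      exact hB x

theorem hasTemperateGrowth_conv {F : Rd d → ℂ} {C : ℝ} (hF : EssBdd F C) (K : 𝓢(Rd d, ℂ)) :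
    (conv K F).HasTemperateGrowth := by
  refine ⟨contDiff_infty.2 fun n => (contDiff_conv_and_bound hF n K).1, fun n => ?_⟩
  obtain ⟨B, hB⟩ := (contDiff_conv_and_bound hF n K).2
  exact ⟨0, B, fun x => by simpa using hB x⟩

theorem EssBdd.conv {F : Rd d → ℂ} {C : ℝ} (hF : EssBdd F C) (K : 𝓢(Rd d, ℂ)) :
    EssBdd (conv K F) ((∫ y, ‖K y‖) * C) :=
  ⟨(hasTemperateGrowth_conv hF K).1.continuous.aestronglyMeasurable,
    Filter.Eventually.of_forall (norm_conv_le hF K)⟩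

theorem conv_sub {F G : Rd d → ℂ} {C C' : ℝ} (hF : EssBdd F C) (hG : EssBdd G C')
    (K : 𝓢(Rd d, ℂ)) (x : Rd d) : conv K (fun y => F y - G y) x = conv K F x - conv K G x := by
  simp only [conv, sub_smul]
  exact integral_sub (integrable_conv hF K x) (integrable_conv hG K x)

theorem conv_const_mul (c : ℂ) (F : Rd d → ℂ) (K : 𝓢(Rd d, ℂ)) (x : Rd d) :
    conv K (fun y => c * F y) x = c * conv K F x := by
  simp only [conv, smul_eq_mul, mul_assoc]
  exact integral_const_mul _ _

theorem conv_mul_const (c : ℂ) (F : Rd d → ℂ) (K : 𝓢(Rd d, ℂ)) (x : Rd d) :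
    conv K (fun y => F y * c) x = conv K F x * c := by
  simp only [mul_comm _ c, conv_const_mul]

theorem conv_sum {ι : Type*} (s : Finset ι) {F : ι → Rd d → ℂ} {C : ι → ℝ}
    (hF : ∀ i ∈ s, EssBdd (F i) (C i)) (K : 𝓢(Rd d, ℂ)) (x : Rd d) :
    conv K (fun y => ∑ i ∈ s, F i y) x = ∑ i ∈ s, conv K (F i) x := by
  simp only [conv, Finset.sum_smul]
  exact integral_finsetSum _ fun i hi => integrable_conv (hF i hi) K x

theorem sum_conv {ι : Type*} (s : Finset ι) {F : Rd d → ℂ} {C : ℝ} (hF : EssBdd F C)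
    (K : ι → 𝓢(Rd d, ℂ)) (x : Rd d) :
    conv (∑ i ∈ s, K i) F x = ∑ i ∈ s, conv (K i) F x := by
  simp only [conv, _root_.sum_apply, Finset.smul_sum]
  exact integral_finsetSum _ fun i _ => integrable_conv hF (K i) x

theorem conv_const (K : 𝓢(Rd d, ℂ)) (c : ℂ) (x : Rd d) :
    conv K (fun _ => c) x = c * ∫ y, K y := by
  simp only [conv, smul_eq_mul]
  rw [integral_const_mul, integral_sub_left_eq_self (fun y => K y) volume x]

/-- The weighted integral `∫ |K(z)| (1 + λ |z|)^α dz`. -/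
def moment (α l : ℝ) (K : 𝓢(Rd d, ℂ)) : ℝ := ∫ z, ‖K z‖ * (1 + l * ‖z‖) ^ α

theorem integrable_moment {α l : ℝ} (hα : 0 ≤ α) (hl : 0 ≤ l) (K : 𝓢(Rd d, ℂ)) :
    Integrable (fun z => ‖K z‖ * (1 + l * ‖z‖) ^ α) := by
  obtain ⟨N, hN⟩ := exists_nat_ge α
  have h := (K.integrable_pow_mul volume 0).add (K.integrable_pow_mul volume N)
  refine (h.const_mul ((1 + l) ^ N * 2 ^ (N - 1))).mono' ?_ (Filter.Eventually.of_forall fun z => ?_)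
  · exact (Continuous.mul (by fun_prop)
      (Continuous.rpow_const (by fun_prop) fun z => Or.inr hα)).aestronglyMeasurable
  · have h1 : (1 + l * ‖z‖) ^ α ≤ (1 + l) ^ N * (2 ^ (N - 1) * (1 + ‖z‖ ^ N)) := by
      calc (1 + l * ‖z‖) ^ α ≤ (1 + l * ‖z‖) ^ (N : ℝ) :=
            Real.rpow_le_rpow_of_exponent_le (by nlinarith [norm_nonneg z]) hN
        _ = (1 + l * ‖z‖) ^ N := Real.rpow_natCast _ _
        _ ≤ ((1 + l) * (1 + ‖z‖)) ^ N := by gcongr; nlinarith [norm_nonneg z]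
        _ = (1 + l) ^ N * (1 + ‖z‖) ^ N := mul_pow _ _ _
        _ ≤ _ := by
          gcongr
          simpa using add_pow_le zero_le_one (norm_nonneg z) N
    rw [norm_mul, norm_norm, Real.norm_of_nonneg (by positivity)]
    calc ‖K z‖ * (1 + l * ‖z‖) ^ α ≤ ‖K z‖ * ((1 + l) ^ N * (2 ^ (N - 1) * (1 + ‖z‖ ^ N))) := by gcongr
      _ = _ := by simp only [Pi.add_apply, pow_zero]; ring

theorem moment_nonneg {α l : ℝ} (hl : 0 ≤ l) (K : 𝓢(Rd d, ℂ)) : 0 ≤ moment α l K :=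
  integral_nonneg fun z => by positivity

theorem integral_norm_eq_moment (l : ℝ) (K : 𝓢(Rd d, ℂ)) : ∫ z, ‖K z‖ = moment 0 l K := by
  simp [moment]

/-- The weight is submultiplicative: 1 + l|z−y| ≤ (1 + l|x−y|)(1 + l|x−z|). Averaging therefore
preserves a weighted bound centred at y, at the cost of one moment of the kernel. -/
theorem norm_conv_le_weight {α l : ℝ} (hα : 0 ≤ α) (hl : 0 ≤ l) {F : Rd d → ℂ} {B : ℝ} (hB : 0 ≤ B)
    {y : Rd d} (hF : ∀ᵐ z, ‖F z‖ ≤ B * (1 + l * ‖z - y‖) ^ α) (K : 𝓢(Rd d, ℂ)) (x : Rd d) :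
    ‖conv K F x‖ ≤ B * moment α l K * (1 + l * ‖x - y‖) ^ α := by
  have h_int := (integrable_moment hα hl K).comp_sub_left x
  refine (norm_integral_le_of_norm_le
    (h_int.const_mul (B * (1 + l * ‖x - y‖) ^ α)) ?_).trans (le_of_eq ?_)
  · filter_upwards [hF] with z hz
    rw [norm_smul]
    have h1 : (1 + l * ‖z - y‖) ^ α ≤ (1 + l * ‖x - y‖) ^ α * (1 + l * ‖x - z‖) ^ α := by
      rw [← Real.mul_rpow (by positivity) (by positivity)]
      refine Real.rpow_le_rpow (by positivity) ?_ hα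
      have h2 : ‖z - y‖ ≤ ‖x - y‖ + ‖x - z‖ := by
        simpa using norm_sub_le (x - y) (x - z)
      have h3 : 0 ≤ l * ‖x - y‖ * (l * ‖x - z‖) := by positivity
      nlinarith [mul_le_mul_of_nonneg_left h2 hl]
    calc ‖F z‖ * ‖K (x - z)‖
        ≤ B * ((1 + l * ‖x - y‖) ^ α * (1 + l * ‖x - z‖) ^ α) * ‖K (x - z)‖ := by
          gcongr
          exact hz.trans (by gcongr)
      _ = _ := by ring
  · rw [integral_const_mul, integral_sub_left_eq_self (fun z => ‖K z‖ * (1 + l * ‖z‖) ^ α) volume x,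
      moment]
    ring

/-! ### Fourier transform -/

theorem fourier_translate (K : 𝓢(Rd d, ℂ)) (y η : Rd d) :
    𝓕 (K.compSubConstCLM ℂ y) η = Real.fourierChar (-inner ℝ y η) • 𝓕 K η := by
  simp only [SchwartzMap.fourier_coe]
  have h := congrFun (VectorFourier.fourierIntegral_comp_add_right Real.fourierChar volume
    (innerₗ (Rd d)) K (-y)) η
  simp only [map_neg, LinearMap.neg_apply, innerₗ_apply_apply] at h
  have hK : ⇑(K.compSubConstCLM ℂ y) = K ∘ fun v => v + -y := by
    ext v
    simp [sub_eq_add_neg]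
  rw [hK]
  exact h

theorem smulLeftCLM_schwartz_apply (θ φ : 𝓢(Rd d, ℂ)) (x : Rd d) :
    SchwartzMap.smulLeftCLM ℂ θ φ x = θ x * φ x := by
  rw [SchwartzMap.smulLeftCLM_apply_apply θ.hasTemperateGrowth, smul_eq_mul]

/-- Parseval for 𝓕⁻φ and a translate of 𝓕⁻θ. It identifies the transpose of the multiplier θ, which
defines its action on distributions, as an integral operator. -/
theorem fourier_smul_fourierInv_apply (θ φ : 𝓢(Rd d, ℂ)) (y : Rd d) :
    𝓕 (SchwartzMap.smulLeftCLM ℂ θ (𝓕⁻ φ)) y = ∫ x, φ x * (𝓕⁻ θ) (x - y) := by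
  have h := SchwartzMap.integral_fourier_mul_eq (𝓕⁻ φ) ((𝓕⁻ θ).compSubConstCLM ℂ y)
  simp only [FourierTransform.fourier_fourierInv_eq, SchwartzMap.compSubConstCLM_apply,
    fourier_translate] at h
  rw [h, SchwartzMap.fourier_coe, Real.fourier_eq]
  refine integral_congr_ae (Filter.Eventually.of_forall fun x => ?_)
  simp only [smulLeftCLM_schwartz_apply, real_inner_comm x y, Circle.smul_def, smul_eq_mul]
  ring

theorem integral_conv_mul {F : Rd d → ℂ} {C : ℝ} (hF : EssBdd F C) (K φ : 𝓢(Rd d, ℂ)) :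
    ∫ x, φ x * conv K F x = ∫ y, (∫ x, φ x * K (x - y)) * F y := by
  have h1 : Integrable (fun p : Rd d × Rd d => φ p.1 * K (p.1 - p.2)) (volume.prod volume) := by
    have hK : Integrable (fun z => K (-z)) := K.integrable.comp_neg
    have := (φ.integrable (μ := volume)).convolution_integrand (ContinuousLinearMap.mul ℝ ℂ) hK
      (μ := volume)
    have := this.swap
    simpa [Function.comp_def] using this
  have h2 : Integrable (Function.uncurry fun x y => φ x * (F y * K (x - y)))
      (volume.prod volume) := by
    refine (h1.norm.const_mul C).mono' ?_ ?_
    · have hF2 : AEStronglyMeasurable (fun p : Rd d × Rd d => F p.2) (volume.prod volume) :=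
        hF.aesm.comp_snd
      have := hF2.mul h1.aestronglyMeasurable
      refine this.congr (Filter.Eventually.of_forall fun p => ?_)
      simp only [Function.uncurry, Pi.mul_apply]
      ring
    · have hb : ∀ᵐ p : Rd d × Rd d ∂(volume.prod volume), ‖F p.2‖ ≤ C :=
        Measure.quasiMeasurePreserving_snd.ae hF.bound
      filter_upwards [hb] with p hp
      have : Function.uncurry (fun x y => φ x * (F y * K (x - y))) p
          = F p.2 * (φ p.1 * K (p.1 - p.2)) := by
        simp only [Function.uncurry]; ring
      rw [this, norm_mul]
      gcongr
  calc ∫ x, φ x * conv K F x = ∫ x, ∫ y, φ x * (F y * K (x - y)) := by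
        simp only [conv, smul_eq_mul, integral_const_mul]
    _ = ∫ y, ∫ x, φ x * (F y * K (x - y)) := integral_integral_swap h2
    _ = _ := by
        refine integral_congr_ae (Filter.Eventually.of_forall fun y => ?_)
        simp only [← integral_mul_const]
        congr 1
        ext x
        ring

/-! ### Distributions represented by bounded functions -/

/-- The tempered distribution `u` is represented by the function `F`, essentially bounded by `C`. -/
structure Rep (u : 𝓢'(Rd d, ℂ)) (F : Rd d → ℂ) (C : ℝ) : Prop where
  essBdd : EssBdd F C
  apply_eq : ∀ φ : 𝓢(Rd d, ℂ), u φ = ∫ x, φ x * F x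

theorem EssBdd.integrable_mul {F : Rd d → ℂ} {C : ℝ} (hF : EssBdd F C) (φ : 𝓢(Rd d, ℂ)) :
    Integrable (fun x => φ x * F x) := by
  simpa only [mul_comm] using φ.integrable.bdd_mul hF.aesm hF.bound

theorem Rep.mono {u : 𝓢'(Rd d, ℂ)} {F : Rd d → ℂ} {C C' : ℝ} (h : Rep u F C) (hC : C ≤ C') :
    Rep u F C' :=
  ⟨h.essBdd.mono hC, h.apply_eq⟩

/-- Lets a crude constant, produced by algebra on representatives, be replaced by a sharp one that
sees cancellation. -/
theorem Rep.of_bound {u : 𝓢'(Rd d, ℂ)} {F : Rd d → ℂ} {C C' : ℝ} (h : Rep u F C)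
    (hC : ∀ x, ‖F x‖ ≤ C') : Rep u F C' :=
  ⟨⟨h.essBdd.aesm, Filter.Eventually.of_forall hC⟩, h.apply_eq⟩

theorem Rep.norm_apply_le {u : 𝓢'(Rd d, ℂ)} {F : Rd d → ℂ} {C : ℝ} (h : Rep u F C)
    (φ : 𝓢(Rd d, ℂ)) : ‖u φ‖ ≤ C * ∫ x, ‖φ x‖ := by
  rw [h.apply_eq, ← integral_const_mul]
  refine norm_integral_le_of_norm_le (φ.integrable.norm.const_mul C) ?_
  filter_upwards [h.essBdd.bound] with x hx
  rw [norm_mul, mul_comm]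
  gcongr

theorem rep_zero : Rep (0 : 𝓢'(Rd d, ℂ)) (fun _ => 0) 0 :=
  ⟨by simpa using essBdd_const (d := d) 0, fun φ => by simp⟩

theorem Rep.add {u v : 𝓢'(Rd d, ℂ)} {F G : Rd d → ℂ} {C C' : ℝ} (hu : Rep u F C)
    (hv : Rep v G C') : Rep (u + v) (fun x => F x + G x) (C + C') :=
  ⟨hu.essBdd.add hv.essBdd, fun φ => by
    simp only [mul_add]
    rw [integral_add (hu.essBdd.integrable_mul φ) (hv.essBdd.integrable_mul φ), ← hu.apply_eq,
      ← hv.apply_eq]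
    rfl⟩

theorem Rep.sub {u v : 𝓢'(Rd d, ℂ)} {F G : Rd d → ℂ} {C C' : ℝ} (hu : Rep u F C)
    (hv : Rep v G C') : Rep (u - v) (fun x => F x - G x) (C + C') :=
  ⟨hu.essBdd.sub hv.essBdd, fun φ => by
    simp only [mul_sub]
    rw [integral_sub (hu.essBdd.integrable_mul φ) (hv.essBdd.integrable_mul φ), ← hu.apply_eq,
      ← hv.apply_eq]
    rfl⟩

theorem Rep.sum {ι : Type*} (s : Finset ι) {u : ι → 𝓢'(Rd d, ℂ)} {F : ι → Rd d → ℂ} {C : ι → ℝ}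
    (h : ∀ i ∈ s, Rep (u i) (F i) (C i)) :
    Rep (∑ i ∈ s, u i) (fun x => ∑ i ∈ s, F i x) (∑ i ∈ s, C i) := by
  classical
  induction s using Finset.induction_on with
  | empty => simpa using rep_zero (d := d)
  | insert i s his ih =>
    simp only [Finset.sum_insert his]
    exact (h i (Finset.mem_insert_self i s)).add
      (ih fun j hj => h j (Finset.mem_insert_of_mem hj))

theorem essBdd_of_memLp {f : Rd d → ℂ} (hf : MemLp f ∞ volume) :
    EssBdd f (eLpNorm f ∞ volume).toReal := by
  refine ⟨hf.1, ?_⟩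
  have h := ae_le_eLpNormEssSup (f := f) (μ := (volume : Measure (Rd d)))
  filter_upwards [h] with x hx
  rw [← eLpNorm_exponent_top] at hx
  rw [← toReal_enorm]
  exact ENNReal.toReal_mono hf.2.ne hx

theorem rep_distOf {f : Rd d → ℂ} (hf : MemLp f ∞ volume) :
    Rep (distOf f hf) f (eLpNorm f ∞ volume).toReal := by
  refine ⟨essBdd_of_memLp hf, fun φ => ?_⟩
  rw [distOf, Lp.toTemperedDistribution_apply]
  refine integral_congr_ae ?_
  filter_upwards [hf.coeFn_toLp] with x hx
  rw [hx, smul_eq_mul]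

theorem Rep.linftyNorm_le {u : 𝓢'(Rd d, ℂ)} {F : Rd d → ℂ} {C : ℝ} (h : Rep u F C) :
    linftyNorm u ≤ ENNReal.ofReal C := by
  have hF : MemLp F ∞ volume := memLp_top_of_bound h.essBdd.aesm C h.essBdd.bound
  have hu : (distOf F hF) = u := by
    ext φ
    rw [(rep_distOf hF).apply_eq, h.apply_eq]
  refine (iInf₂_le (hF.toLp F) hu).trans ?_
  rw [Lp.enorm_toLp, eLpNorm_exponent_top]
  exact eLpNormEssSup_le_of_ae_bound h.essBdd.bound

theorem exists_rep_of_linftyNorm_lt {u : 𝓢'(Rd d, ℂ)} {C : ℝ} (hC : 0 ≤ C)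
    (h : linftyNorm u < ENNReal.ofReal C) : ∃ F, Rep u F C := by
  simp only [linftyNorm, iInf_lt_iff] at h
  obtain ⟨f, hf, hlt⟩ := h
  refine ⟨f, (?_ : Rep u f (eLpNorm f ∞ volume).toReal).mono ?_⟩
  · have hmem := Lp.memLp f
    have h1 := rep_distOf hmem
    rwa [distOf, Lp.toLp_coeFn, hf] at h1
  · rw [Lp.enorm_def] at hlt
    exact ENNReal.toReal_le_of_le_ofReal hC hlt.le

theorem Rep.smulLeft {u : 𝓢'(Rd d, ℂ)} {F h : Rd d → ℂ} {C C' : ℝ} (hu : Rep u F C)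
    (hh : h.HasTemperateGrowth) (hb : EssBdd h C') :
    Rep (smulLeftCLM ℂ h u) (fun x => h x * F x) (C' * C) := by
  refine ⟨hb.mul hu.essBdd, fun φ => ?_⟩
  rw [smulLeftCLM_apply_apply, hu.apply_eq]
  congr 1
  ext x
  rw [SchwartzMap.smulLeftCLM_apply_apply hh, smul_eq_mul]
  ring

theorem Rep.multiplier {u : 𝓢'(Rd d, ℂ)} {F : Rd d → ℂ} {C : ℝ} (hu : Rep u F C)
    (θ : 𝓢(Rd d, ℂ)) :
    Rep (fourierMultiplierCLM ℂ θ u) (conv (𝓕⁻ θ) F) ((∫ y, ‖(𝓕⁻ θ) y‖) * C) := by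
  refine ⟨hu.essBdd.conv _, fun φ => ?_⟩
  rw [fourierMultiplierCLM_apply_apply, hu.apply_eq, integral_conv_mul hu.essBdd]
  simp only [fourier_smul_fourierInv_apply]

/-! ### Spectral localization of products -/

/-- The value at ξ is the pairing of θ(D)F with the Fourier transform of ψ(· + ξ). Moving θ(D) onto
the test function produces the product θ · ψ(· + ξ), which vanishes. -/
theorem fourierInv_conv_mul_fourier_eq_zero {F : Rd d → ℂ} {C : ℝ} (hF : EssBdd F C)
    {θ ψ : 𝓢(Rd d, ℂ)} {ξ : Rd d} (h : ∀ η, θ η ≠ 0 → ψ (η + ξ) = 0) :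
    𝓕⁻ (SchwartzMap.smulLeftCLM ℂ (conv (𝓕⁻ θ) F) (𝓕 ψ)) ξ = 0 := by
  set ψ' := ψ.compSubConstCLM ℂ (-ξ) with hψ'
  have h1 : 𝓕⁻ (SchwartzMap.smulLeftCLM ℂ (conv (𝓕⁻ θ) F) (𝓕 ψ)) ξ
      = ∫ x, 𝓕 ψ' x * conv (𝓕⁻ θ) F x := by
    rw [SchwartzMap.fourierInv_coe, Real.fourierInv_eq]
    congr 1
    ext x
    rw [hψ', fourier_translate, SchwartzMap.smulLeftCLM_apply_apply (hasTemperateGrowth_conv hF _),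
      inner_neg_left, neg_neg, real_inner_comm x ξ]
    simp only [Circle.smul_def, smul_eq_mul]
    ring
  have h2 : SchwartzMap.smulLeftCLM ℂ θ ψ' = 0 := by
    ext η
    rw [smulLeftCLM_schwartz_apply, hψ', SchwartzMap.compSubConstCLM_apply, sub_neg_eq_add]
    by_cases hη : θ η = 0
    · simp [hη]
    · simp [h η hη]
  rw [h1, integral_conv_mul hF]
  simp_rw [← fourier_smul_fourierInv_apply, FourierTransform.fourierInv_fourier_eq, h2]
  have h3 : 𝓕 (0 : 𝓢(Rd d, ℂ)) = 0 := map_zero (FourierTransform.fourierCLM ℂ 𝓢(Rd d, ℂ))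
  simp [h3]

/-- The spectrum of a product lies in the sum of the spectra, phrased by testing so that no
convolution of distributions is needed. -/
theorem smulLeft_conv_multiplier_apply_fourier_eq_zero {F : Rd d → ℂ} {C : ℝ} (hF : EssBdd F C)
    {θ ρ ψ : 𝓢(Rd d, ℂ)} (h : ∀ η ξ, θ η ≠ 0 → ρ ξ ≠ 0 → ψ (η + ξ) = 0) (v : 𝓢'(Rd d, ℂ)) :
    smulLeftCLM ℂ (conv (𝓕⁻ θ) F) (fourierMultiplierCLM ℂ ρ v) (𝓕 ψ) = 0 := by
  rw [smulLeftCLM_apply_apply, fourierMultiplierCLM_apply_apply]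
  have h1 : SchwartzMap.smulLeftCLM ℂ ρ
      (𝓕⁻ (SchwartzMap.smulLeftCLM ℂ (conv (𝓕⁻ θ) F) (𝓕 ψ))) = 0 := by
    ext ξ
    rw [smulLeftCLM_schwartz_apply]
    by_cases hξ : ρ ξ = 0
    · simp [hξ]
    · simp [fourierInv_conv_mul_fourier_eq_zero hF fun η hη => h η ξ hη hξ]
  have h3 : 𝓕 (0 : 𝓢(Rd d, ℂ)) = 0 := map_zero (FourierTransform.fourierCLM ℂ 𝓢(Rd d, ℂ))
  rw [h1, h3, map_zero]

/-! ### Scaling -/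

theorem fourierInv_scaling {θ θ' : 𝓢(Rd d, ℂ)} {l : ℝ} (hl : 0 < l)
    (h : ∀ ξ, θ' ξ = θ (l⁻¹ • ξ)) (x : Rd d) :
    (𝓕⁻ θ') x = (l ^ Module.finrank ℝ (Rd d) : ℝ) • (𝓕⁻ θ) (l • x) := by
  simp only [SchwartzMap.fourierInv_coe, Real.fourierInv_eq]
  have h1 := Measure.integral_comp_smul volume
    (fun v : Rd d => Real.fourierChar (inner ℝ v (l • x)) • θ v) l⁻¹
  have h2 : ∀ v : Rd d, inner ℝ (l⁻¹ • v) (l • x) = (inner ℝ v x : ℝ) := fun v => by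
    rw [real_inner_smul_left, real_inner_smul_right, ← mul_assoc, inv_mul_cancel₀ hl.ne', one_mul]
  simp only [h2, ← h] at h1
  rw [h1, abs_of_nonneg (by positivity), inv_pow, inv_inv]

/-- Dilating the symbol by l turns the kernel K into l^d K(l ·), and the substitution z ↦ l z
absorbs both the factor l^d and the l in the weight. This is what makes the dyadic kernel bounds
uniform. -/
theorem moment_scaling {θ θ' : 𝓢(Rd d, ℂ)} {l : ℝ} (hl : 0 < l)
    (h : ∀ ξ, θ' ξ = θ (l⁻¹ • ξ)) (α : ℝ) :
    moment α l (𝓕⁻ θ') = moment α 1 (𝓕⁻ θ) := by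
  have h1 := Measure.integral_comp_smul volume
    (fun v : Rd d => ‖(𝓕⁻ θ) v‖ * (1 + 1 * ‖v‖) ^ α) l
  rw [moment, moment]
  have hpos : 0 < l ^ Module.finrank ℝ (Rd d) := by positivity
  have h2 : ∀ z : Rd d, ‖(𝓕⁻ θ') z‖ * (1 + l * ‖z‖) ^ α
      = l ^ Module.finrank ℝ (Rd d) * (‖(𝓕⁻ θ) (l • z)‖ * (1 + 1 * ‖l • z‖) ^ α) := fun z => by
    rw [fourierInv_scaling hl h, norm_smul, norm_smul, Real.norm_of_nonneg hpos.le,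
      Real.norm_of_nonneg hl.le, one_mul, mul_assoc]
  simp only [h2]
  rw [integral_const_mul, h1, abs_of_nonneg (by positivity), smul_eq_mul,
    mul_inv_cancel_left₀ (ne_of_gt hpos)]

/-! ### Frequency supports -/

theorem fourier_sub_schwartz (φ ψ : 𝓢(Rd d, ℂ)) : 𝓕 (φ - ψ) = 𝓕 φ - 𝓕 ψ :=
  map_sub (FourierTransform.fourierCLM ℂ 𝓢(Rd d, ℂ)) _ _

/-- The indices at distance at most `4` from `k`. -/
def window (k : ℕ) : Finset ℕ := Finset.Icc (k - 4) (k + 4)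

theorem mem_window {j k : ℕ} : j ∈ window k ↔ k ≤ j + 4 ∧ j ≤ k + 4 := by
  rw [window, Finset.mem_Icc]
  omega

theorem mem_window_comm {j k : ℕ} : j ∈ window k ↔ k ∈ window j := by
  rw [mem_window, mem_window, and_comm]

namespace DyadicPartition

variable (D : DyadicPartition d)

theorem rhoSchwartz_apply (n : ℕ) (x : Rd d) : D.rhoSchwartz n x = (D.rho n x : ℂ) := rfl

theorem block_eq (n : ℕ) : D.block n = fourierMultiplierCLM ℂ (D.rhoSchwartz n) := rfl

theorem norm_lt_of_rho_ne_zero {n : ℕ} {x : Rd d} (h : D.rho n x ≠ 0) :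
    ‖x‖ < 4 / 3 * 2 ^ n := by
  cases n with
  | zero => simpa using D.tsupport_rho_zero (subset_tsupport _ h)
  | succ n =>
    rw [D.rho_scaling] at h
    have h1 := (D.tsupport_rho_one (subset_tsupport _ h)).2
    rw [norm_smul, norm_inv, Real.norm_of_nonneg (by positivity), inv_mul_lt_iff₀ (by positivity)]
      at h1
    rw [pow_succ]
    linarith

theorem lt_norm_of_rho_ne_zero {n : ℕ} (hn : n ≠ 0) {x : Rd d} (h : D.rho n x ≠ 0) :
    3 / 8 * 2 ^ n < ‖x‖ := by
  obtain ⟨n, rfl⟩ := Nat.exists_eq_succ_of_ne_zero hn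
  rw [Nat.succ_eq_add_one, D.rho_scaling] at h
  have h1 := (D.tsupport_rho_one (subset_tsupport _ h)).1
  rw [norm_smul, norm_inv, Real.norm_of_nonneg (by positivity), lt_inv_mul_iff₀ (by positivity)]
    at h1
  rw [Nat.succ_eq_add_one, pow_succ]
  linarith

theorem mem_window_of_rho_ne_zero {j k : ℕ} {x : Rd d} (hj : D.rho j x ≠ 0)
    (hk : D.rho k x ≠ 0) : j ∈ window k := by
  have aux : ∀ {j k : ℕ}, D.rho j x ≠ 0 → D.rho k x ≠ 0 → k ≤ j + 4 := by
    intro j k hj hk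
    by_contra! hlt
    have h1 := D.norm_lt_of_rho_ne_zero hj
    have h2 := D.lt_norm_of_rho_ne_zero (by omega : k ≠ 0) hk
    have h3 : (2 : ℝ) ^ (j + 5) ≤ 2 ^ k := pow_le_pow_right₀ one_le_two hlt
    have h4 : (0 : ℝ) < 2 ^ j := by positivity
    rw [pow_add] at h3
    linarith
  exact mem_window.2 ⟨aux hj hk, aux hk hj⟩

/-- The Fourier multiplier `∑_{m < n - 1} rho m` that is applied to the first argument in the `n`-th
term of a paraproduct. -/
def lowSchwartz (n : ℕ) : 𝓢(Rd d, ℂ) := ∑ m ∈ Finset.range (n - 1), D.rhoSchwartz m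

theorem lowSchwartz_apply (n : ℕ) (x : Rd d) :
    D.lowSchwartz n x = ((∑ m ∈ Finset.range (n - 1), D.rho m x : ℝ) : ℂ) := by
  simp [lowSchwartz, rhoSchwartz_apply, _root_.sum_apply]

/-- The partition of unity at x and the one at 2^{-n}x have the same tail by scaling, and both sum
to 1, so their heads agree. -/
theorem lowSchwartz_add_two_apply (n : ℕ) (x : Rd d) :
    D.lowSchwartz (n + 2) x = D.rhoSchwartz 0 (((2 : ℝ) ^ n)⁻¹ • x) := by
  rw [lowSchwartz_apply, rhoSchwartz_apply, show n + 2 - 1 = n + 1 by omega]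
  congr 1
  have h1 := (hasSum_nat_add_iff' (n + 1)).2 (D.hasSum_rho x)
  have h2 := (hasSum_nat_add_iff' 1).2 (D.hasSum_rho (((2 : ℝ) ^ n)⁻¹ • x))
  have h3 : (fun m => D.rho (m + (n + 1)) x)
      = fun m => D.rho (m + 1) (((2 : ℝ) ^ n)⁻¹ • x) := by
    ext m
    rw [← add_assoc, D.rho_scaling (m + n), D.rho_scaling m, smul_smul, pow_add, mul_inv]
  rw [h3] at h1
  have h4 := h1.unique h2
  simp only [Finset.range_one, Finset.sum_singleton] at h4
  linarith

theorem norm_lt_of_lowSchwartz_ne_zero {n : ℕ} {x : Rd d} (h : D.lowSchwartz n x ≠ 0) :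
    2 ≤ n ∧ ‖x‖ < 1 / 3 * 2 ^ n := by
  rcases n with _ | _ | n
  · simp [lowSchwartz] at h
  · simp [lowSchwartz] at h
  · rw [lowSchwartz_add_two_apply, rhoSchwartz_apply, Complex.ofReal_ne_zero] at h
    have h1 := D.norm_lt_of_rho_ne_zero h
    rw [norm_smul, norm_inv, Real.norm_of_nonneg (by positivity), inv_mul_lt_iff₀ (by positivity)]
      at h1
    refine ⟨by omega, ?_⟩
    rw [pow_succ, pow_succ]
    linarith

/-- This fixes the width 4 of the window: |η + ξ| > (3/8 − 1/3) 2^n = 2^n/24, while |η + ξ| < (4/3)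
2^m, so 2^n < 2^{m+5}. -/
theorem mem_window_of_low {m n : ℕ} {η ξ : Rd d} (hη : D.lowSchwartz n η ≠ 0)
    (hξ : D.rho n ξ ≠ 0) (h : D.rho m (η + ξ) ≠ 0) : m ∈ window n := by
  obtain ⟨hn, h1⟩ := D.norm_lt_of_lowSchwartz_ne_zero hη
  have h2 := D.norm_lt_of_rho_ne_zero hξ
  have h3 := D.lt_norm_of_rho_ne_zero (by omega) hξ
  have h4 := norm_add_le η ξ
  have h5 : ‖ξ‖ - ‖η‖ ≤ ‖η + ξ‖ := by
    rw [add_comm]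
    exact norm_sub_le_norm_add ξ η
  have h6 := D.norm_lt_of_rho_ne_zero h
  have h2n : (0 : ℝ) < 2 ^ n := by positivity
  have h2m : (0 : ℝ) < 2 ^ m := by positivity
  rw [mem_window]
  constructor
  · by_contra! hlt
    have h7 : (2 : ℝ) ^ (m + 5) ≤ 2 ^ n := pow_le_pow_right₀ one_le_two hlt
    rw [pow_add] at h7
    linarith
  · by_contra! hlt
    have h7 : (2 : ℝ) ^ (n + 5) ≤ 2 ^ m := pow_le_pow_right₀ one_le_two hlt
    have h8 := D.lt_norm_of_rho_ne_zero (by omega) h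
    rw [pow_add] at h7
    linarith

theorem sum_window_rho_eq_one {k : ℕ} {x : Rd d} (h : ∀ m, D.rho m x ≠ 0 → m ∈ window k) :
    ∑ m ∈ window k, D.rho m x = 1 :=
  (hasSum_sum_of_ne_finset_zero fun m hm => by
    by_contra h0
    exact hm (h m h0)).unique (D.hasSum_rho x)

/-! ### Blocks of paraproduct terms -/

theorem block_block (m n : ℕ) (u : 𝓢'(Rd d, ℂ)) (φ : 𝓢(Rd d, ℂ)) :
    D.block m (D.block n u) φ
      = u (𝓕 (SchwartzMap.smulLeftCLM ℂ (D.rhoSchwartz n)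
          (SchwartzMap.smulLeftCLM ℂ (D.rhoSchwartz m) (𝓕⁻ φ)))) := by
  rw [block_eq, block_eq, fourierMultiplierCLM_apply_apply, fourierMultiplierCLM_apply_apply,
    FourierTransform.fourierInv_fourier_eq]

theorem sum_window_block_block (k : ℕ) (u : 𝓢'(Rd d, ℂ)) :
    ∑ j ∈ window k, D.block k (D.block j u) = D.block k u := by
  ext φ
  rw [_root_.sum_apply]
  simp only [block_block]
  rw [← map_sum, D.block_eq, fourierMultiplierCLM_apply_apply, ← FourierTransform.fourier_sum]
  congr 2
  ext x
  rw [_root_.sum_apply]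
  simp only [smulLeftCLM_schwartz_apply, rhoSchwartz_apply]
  rw [← Finset.sum_mul]
  by_cases hx : D.rho k x = 0
  · simp [hx]
  · rw [← Complex.ofReal_sum, D.sum_window_rho_eq_one fun m hm => D.mem_window_of_rho_ne_zero hm hx]
    simp

theorem blockFun_distOf {a : Rd d → ℂ} (ha : MemLp a ∞ volume) (n : ℕ) :
    D.blockFun n (distOf a ha) = conv (D.kernel n) a := by
  ext x
  rw [blockFun, (rep_distOf ha).apply_eq, conv]
  simp only [kernelAt_apply, smul_eq_mul, mul_comm]

/-- The kernel of the low-frequency projection in the `n`-th term of a paraproduct. -/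
def lowKernel (n : ℕ) : 𝓢(Rd d, ℂ) := 𝓕⁻ (D.lowSchwartz n)

theorem lowKernel_eq_sum (n : ℕ) :
    D.lowKernel n = ∑ m ∈ Finset.range (n - 1), D.kernel m := by
  simp only [lowKernel, lowSchwartz, kernel]
  exact map_sum (FourierTransform.fourierInvCLM ℂ 𝓢(Rd d, ℂ)) _ _

theorem paraTerm_distOf {a : Rd d → ℂ} (ha : MemLp a ∞ volume) (v : 𝓢'(Rd d, ℂ)) (n : ℕ) :
    D.paraTerm (distOf a ha) v n = smulLeftCLM ℂ (conv (D.lowKernel n) a) (D.block n v) := by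
  have hb := essBdd_of_memLp ha
  have h1 : conv (D.lowKernel n) a
      = fun x => ∑ m ∈ Finset.range (n - 1), conv (D.kernel m) a x := by
    ext x
    rw [lowKernel_eq_sum, sum_conv _ hb]
  rw [h1, smulLeftCLM_sum fun m _ => hasTemperateGrowth_conv hb _, _root_.sum_apply, paraTerm]
  simp only [blockFun_distOf]

theorem paraTerm_apply_fourier_eq_zero {a : Rd d → ℂ} (ha : MemLp a ∞ volume) (v : 𝓢'(Rd d, ℂ))
    {n : ℕ} {ψ : 𝓢(Rd d, ℂ)}
    (h : ∀ x, (∀ m, D.rho m x ≠ 0 → m ∈ window n) → ψ x = 0) :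
    D.paraTerm (distOf a ha) v n (𝓕 ψ) = 0 := by
  rw [paraTerm_distOf, block_eq, lowKernel]
  refine smulLeft_conv_multiplier_apply_fourier_eq_zero (essBdd_of_memLp ha) (fun η ξ hη hξ => ?_) v
  rw [rhoSchwartz_apply, Complex.ofReal_ne_zero] at hξ
  exact h _ fun m hm => D.mem_window_of_low hη hξ hm

theorem block_paraTerm_eq_zero {a : Rd d → ℂ} (ha : MemLp a ∞ volume) (v : 𝓢'(Rd d, ℂ))
    {m n : ℕ} (h : n ∉ window m) : D.block m (D.paraTerm (distOf a ha) v n) = 0 := by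
  ext φ
  rw [block_eq, fourierMultiplierCLM_apply_apply]
  refine D.paraTerm_apply_fourier_eq_zero ha v fun x hx => ?_
  rw [smulLeftCLM_schwartz_apply, rhoSchwartz_apply]
  by_cases h0 : D.rho m x = 0
  · simp [h0]
  · exact absurd (mem_window_comm.1 (hx m h0)) h

/-- On the spectrum of the n-th term the functions `rho m`, m in the window, already sum to 1; the
test function `ψ` carries the complementary symbol and is annihilated. -/
theorem sum_window_block_paraTerm {a : Rd d → ℂ} (ha : MemLp a ∞ volume) (v : 𝓢'(Rd d, ℂ))
    (n : ℕ) : ∑ m ∈ window n, D.block m (D.paraTerm (distOf a ha) v n)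
      = D.paraTerm (distOf a ha) v n := by
  ext φ
  set ψ : 𝓢(Rd d, ℂ) :=
    𝓕⁻ φ - ∑ m ∈ window n, SchwartzMap.smulLeftCLM ℂ (D.rhoSchwartz m) (𝓕⁻ φ) with hψ
  have h1 : D.paraTerm (distOf a ha) v n (𝓕 ψ) = 0 := by
    refine D.paraTerm_apply_fourier_eq_zero ha v fun x hx => ?_
    have h2 := D.sum_window_rho_eq_one hx
    rw [hψ, sub_apply, _root_.sum_apply]
    simp only [smulLeftCLM_schwartz_apply, rhoSchwartz_apply]
    rw [← Finset.sum_mul, ← Complex.ofReal_sum, h2]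
    simp
  rw [hψ, fourier_sub_schwartz, FourierTransform.fourier_sum, map_sub, map_sum, sub_eq_zero,
    FourierTransform.fourier_fourierInv_eq] at h1
  rw [h1, _root_.sum_apply]
  rfl

/-! ### Kernel bounds -/

theorem exists_moment_kernel_le (α : ℝ) :
    ∃ M : ℝ, 0 ≤ M ∧ ∀ n, moment α (2 ^ n) (D.kernel (n + 1)) ≤ M :=
  ⟨moment α 1 (𝓕⁻ (D.rhoSchwartz 1)), moment_nonneg zero_le_one _, fun n =>
    (moment_scaling (by positivity) (fun ξ => by
      rw [rhoSchwartz_apply, rhoSchwartz_apply, D.rho_scaling]) α).le⟩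

theorem exists_moment_lowKernel_le (α : ℝ) :
    ∃ M : ℝ, 0 ≤ M ∧ ∀ n, moment α (2 ^ n) (D.lowKernel (n + 2)) ≤ M :=
  ⟨moment α 1 (𝓕⁻ (D.rhoSchwartz 0)), moment_nonneg zero_le_one _, fun n =>
    (moment_scaling (by positivity) (D.lowSchwartz_add_two_apply n) α).le⟩

theorem exists_integral_kernel_le : ∃ M : ℝ, 0 ≤ M ∧ ∀ n, ∫ y, ‖D.kernel n y‖ ≤ M := by
  obtain ⟨M, hM, h⟩ := D.exists_moment_kernel_le 0
  refine ⟨max M (∫ y, ‖D.kernel 0 y‖), le_max_of_le_left hM, fun n => ?_⟩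
  cases n with
  | zero => exact le_max_right _ _
  | succ n =>
    rw [integral_norm_eq_moment (2 ^ n)]
    exact le_max_of_le_left (h n)

theorem exists_integral_lowKernel_le : ∃ M : ℝ, 0 ≤ M ∧ ∀ n, ∫ y, ‖D.lowKernel n y‖ ≤ M := by
  obtain ⟨M, hM, h⟩ := D.exists_moment_lowKernel_le 0
  refine ⟨M, hM, fun n => ?_⟩
  rcases n with _ | _ | n
  -- For n = 0 and n = 1 the sum of kernels is empty.
  · simpa [lowKernel_eq_sum] using hM
  · simpa [lowKernel_eq_sum] using hM
  · rw [integral_norm_eq_moment (2 ^ n)]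
    exact h n

/-- The integral is the symbol at the origin, where only ρ_{-1} is nonzero. The shift by 2 excludes
the two vanishing kernels. -/
theorem integral_lowKernel (n : ℕ) : ∫ y, D.lowKernel (n + 2) y = 1 := by
  have h1 : 𝓕 (D.lowKernel (n + 2)) 0 = ∫ y, D.lowKernel (n + 2) y := by
    rw [SchwartzMap.fourier_coe, Real.fourier_eq]
    simp
  rw [← h1, lowKernel, FourierTransform.fourier_fourierInv_eq, lowSchwartz_add_two_apply, smul_zero,
    rhoSchwartz_apply]
  have h2 : ∀ m ≠ 0, D.rho m 0 = 0 := fun m hm => by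
    by_contra h
    have h3 := D.lt_norm_of_rho_ne_zero hm h
    rw [norm_zero] at h3
    exact absurd h3 (not_lt.2 (by positivity))
  rw [(hasSum_single 0 h2).unique (D.hasSum_rho 0), Complex.ofReal_one]

end DyadicPartition

/-! ### Convergence of paraproducts -/

theorem exists_schwartz_scaling (θ : 𝓢(Rd d, ℂ)) {l : ℝ} (hl : 0 < l) :
    ∃ θ' : 𝓢(Rd d, ℂ), ∀ ξ, θ' ξ = θ (l⁻¹ • ξ) :=
  ⟨SchwartzMap.compCLMOfContinuousLinearEquiv ℂ
    (ContinuousLinearEquiv.smulLeft (Units.mk0 l⁻¹ (inv_ne_zero hl.ne'))) θ, fun _ => rfl⟩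

/-- A series of tempered distributions that decays geometrically when tested against any Schwartz
function, uniformly with respect to some continuous seminorm, converges. -/
theorem summable_of_norm_apply_le {u : ℕ → 𝓢'(Rd d, ℂ)} (A : 𝓢(Rd d, ℂ) →L[ℂ] 𝓢(Rd d, ℂ)) {B : ℝ}
    (h : ∀ n φ, ‖u n φ‖ ≤ B * (1 / 2 : ℝ) ^ n * ∫ x, ‖A φ x‖) : Summable u := by
  have hgeo : ∀ φ : 𝓢(Rd d, ℂ),
      HasSum (fun n => B * (1 / 2 : ℝ) ^ n * ∫ x, ‖A φ x‖) (B * 2 * ∫ x, ‖A φ x‖) := fun φ =>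
    (hasSum_geometric_two.mul_left B).mul_right _
  have hs : ∀ φ, Summable fun n => u n φ := fun φ =>
    Summable.of_norm_bounded (hgeo φ).summable fun n => h n φ
  let L : 𝓢(Rd d, ℂ) →ₗ[ℂ] ℂ :=
    { toFun := fun φ => ∑' n, u n φ
      map_add' := fun φ ψ => by
        simp only [map_add]
        exact (hs φ).tsum_add (hs ψ)
      map_smul' := fun c φ => by
        simp only [map_smul, smul_eq_mul, RingHom.id_apply]
        exact tsum_mul_left }
  have hL : ∀ φ, ‖L φ‖ ≤ B * 2 * ‖SchwartzMap.toLpCLM ℂ ℂ 1 volume (A φ)‖ := fun φ => by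
    rw [SchwartzMap.toLpCLM_apply, SchwartzMap.norm_toLp_one]
    exact tsum_of_norm_bounded (hgeo φ) fun n => h n φ
  have hcont : Continuous L := by
    refine continuous_of_continuousAt_zero L ?_
    have h1 : Continuous fun φ => B * 2 * ‖SchwartzMap.toLpCLM ℂ ℂ 1 volume (A φ)‖ := by fun_prop
    have h2 := h1.tendsto 0
    simp only [map_zero, norm_zero, mul_zero] at h2
    rw [ContinuousAt, map_zero]
    exact squeeze_zero_norm hL h2
  let L' : 𝓢'(Rd d, ℂ) :=
    ContinuousLinearMap.toPointwiseConvergenceCLM ℂ (RingHom.id ℂ) 𝓢(Rd d, ℂ) ℂ ⟨L, hcont⟩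
  refine ⟨L', ?_⟩
  rw [HasSum, PointwiseConvergenceCLM.tendsto_iff_forall_tendsto]
  intro φ
  have h3 := (hs φ).hasSum
  rw [HasSum] at h3
  refine h3.congr fun s => ?_
  rw [_root_.sum_apply]

theorem card_window_le (k : ℕ) : ((window k).card : ℝ) ≤ 9 := by
  have h : (window k).card ≤ 9 := by
    rw [window, Nat.card_Icc]
    omega
  exact_mod_cast h

theorem rpow_neg_mul_le_of_mem_window (β : ℝ) {j k : ℕ} (h : j ∈ window k) :
    (2 : ℝ) ^ (-β * j) ≤ 2 ^ (4 * |β|) * 2 ^ (-β * k) := by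
  rw [← Real.rpow_add two_pos]
  refine Real.rpow_le_rpow_of_exponent_le one_le_two ?_
  rw [mem_window] at h
  have h1 : (k : ℝ) ≤ j + 4 := by exact_mod_cast h.1
  have h2 : (j : ℝ) ≤ k + 4 := by exact_mod_cast h.2
  have h3 : |(k : ℝ) - j| ≤ 4 := abs_le.2 ⟨by linarith, by linarith⟩
  have h4 : β * ((k : ℝ) - j) ≤ |β| * 4 :=
    (le_abs_self _).trans (by rw [abs_mul]; gcongr)
  linarith

namespace DyadicPartition

variable (D : DyadicPartition d)

/-- The Schwartz function `ρ_0(ξ) / |ξ|^{2M}`. -/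
def rhoDivSchwartz (M : ℕ) : 𝓢(Rd d, ℂ) :=
  HasCompactSupport.toSchwartzMap (f := fun x => D.rhoSchwartz 1 x / ((‖x‖ ^ 2) ^ M : ℝ))
    (by
      simp only [div_eq_mul_inv]
      exact (D.hasCompactSupport_ofReal_rho 1).mul_right)
    (by
      refine contDiff_iff_contDiffAt.2 fun x => ?_
      by_cases hx : x = 0
      · subst hx
        have h0 : (0 : Rd d) ∉ tsupport (D.rho 1) := fun h => by
          have := (D.tsupport_rho_one h).1
          rw [norm_zero] at this
          norm_num at this
        refine (contDiffAt_const (c := (0 : ℂ))).congr_of_eventuallyEq ?_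
        filter_upwards [notMem_tsupport_iff_eventuallyEq.1 h0] with y hy
        simp [rhoSchwartz_apply, hy]
      · simp only [div_eq_mul_inv]
        refine ((D.contDiff_ofReal_rho 1).contDiffAt).mul (ContDiffAt.inv ?_ ?_)
        · exact (Complex.ofRealCLM.contDiff.comp ((contDiff_norm_sq ℝ).pow M)).contDiffAt
        · rw [Complex.ofReal_ne_zero]
          exact pow_ne_zero _ (pow_ne_zero _ (norm_ne_zero_iff.2 hx)))

theorem rhoDivSchwartz_apply (M : ℕ) (x : Rd d) :
    D.rhoDivSchwartz M x = D.rhoSchwartz 1 x / ((‖x‖ ^ 2) ^ M : ℝ) := rfl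

theorem rho_succ_eq (M m : ℕ) (x : Rd d) :
    D.rhoSchwartz (m + 1) x = ((((2 : ℝ) ^ m)⁻¹ ^ 2) ^ M : ℝ) *
      (D.rhoDivSchwartz M (((2 : ℝ) ^ m)⁻¹ • x) * ((‖x‖ ^ 2) ^ M : ℝ)) := by
  rw [rhoDivSchwartz_apply, rhoSchwartz_apply, rhoSchwartz_apply, D.rho_scaling]
  by_cases hx : x = 0
  · subst hx
    have h0 : D.rho 1 (0 : Rd d) = 0 := by
      by_contra h
      have := D.lt_norm_of_rho_ne_zero one_ne_zero h
      rw [norm_zero] at this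
      norm_num at this
    simp [h0]
  · have hx' : ‖x‖ ≠ 0 := norm_ne_zero_iff.2 hx
    rw [norm_smul, Real.norm_of_nonneg (by positivity)]
    norm_cast
    rw [mul_pow, mul_pow]
    field_simp

/-- The operator `(-Δ)^M` on Schwartz functions, up to a constant. -/
def powLaplacian (M : ℕ) : 𝓢(Rd d, ℂ) →L[ℂ] 𝓢(Rd d, ℂ) :=
  FourierTransform.fourierCLM ℂ 𝓢(Rd d, ℂ) ∘L
    SchwartzMap.smulLeftCLM ℂ (fun x : Rd d => (((‖x‖ ^ 2) ^ M : ℝ) : ℂ)) ∘L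
    FourierTransform.fourierInvCLM ℂ 𝓢(Rd d, ℂ)

theorem hasTemperateGrowth_norm_sq_pow (M : ℕ) :
    (fun x : Rd d => (((‖x‖ ^ 2) ^ M : ℝ) : ℂ)).HasTemperateGrowth := by
  fun_prop

/-- On an annulus of radius about 2^m the symbol factors as 2^{-2mM} θ(ξ)|ξ|^{2M}, with θ a dilate
of a fixed function. The factor |ξ|^{2M} goes to the test function, and the kernel of θ has L¹ norm
independent of m. -/
theorem exists_norm_block_apply_le (M : ℕ) : ∃ C : ℝ, 0 ≤ C ∧
    ∀ (m : ℕ) {u : 𝓢'(Rd d, ℂ)} {F : Rd d → ℂ} {B : ℝ}, Rep u F B → ∀ φ,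
      ‖D.block (m + 1) u φ‖
        ≤ (((2 : ℝ) ^ m)⁻¹ ^ 2) ^ M * (C * B * ∫ x, ‖powLaplacian M φ x‖) := by
  refine ⟨moment 0 1 (𝓕⁻ (D.rhoDivSchwartz M)), moment_nonneg zero_le_one _, ?_⟩
  intro m u F B hu φ
  have hl : (0 : ℝ) < 2 ^ m := by positivity
  obtain ⟨θ, hθ⟩ := exists_schwartz_scaling (D.rhoDivSchwartz M) hl
  have h1 : D.block (m + 1) u φ = ((((2 : ℝ) ^ m)⁻¹ ^ 2) ^ M : ℝ) *
      fourierMultiplierCLM ℂ θ u (powLaplacian M φ) := by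
    rw [block_eq, fourierMultiplierCLM_apply_apply, fourierMultiplierCLM_apply_apply, ← smul_eq_mul,
      ← map_smul, ← FourierTransform.fourier_smul]
    congr 2
    ext x
    rw [smulLeftCLM_schwartz_apply, smul_apply, smulLeftCLM_schwartz_apply, D.rho_succ_eq M, hθ]
    simp only [powLaplacian, ContinuousLinearMap.comp_apply, FourierTransform.fourierCLM_apply,
      FourierTransform.fourierInvCLM_apply, FourierTransform.fourierInv_fourier_eq]
    rw [SchwartzMap.smulLeftCLM_apply_apply (hasTemperateGrowth_norm_sq_pow M)]
    simp only [smul_eq_mul]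
    ring
  rw [h1, norm_mul, Complex.norm_real, Real.norm_of_nonneg (by positivity)]
  have h2 := (hu.multiplier θ).norm_apply_le (powLaplacian M φ)
  rw [integral_norm_eq_moment (2 ^ m), moment_scaling hl hθ] at h2
  gcongr

/-- The blocks of `v` are bounded functions, of size `O(2^{-β n})`. -/
def BlockBound (β : ℝ) (v : 𝓢'(Rd d, ℂ)) (C : ℝ) (G : ℕ → Rd d → ℂ) : Prop :=
  ∀ n : ℕ, Rep (D.block n v) (G n) (C * (2 : ℝ) ^ (-β * n))

theorem exists_blockBound_of_memHolder {β : ℝ} {v : 𝓢'(Rd d, ℂ)} (h : D.MemHolder β v) :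
    ∃ C G, 0 ≤ C ∧ D.BlockBound β v C G := by
  set H := (D.holderNorm β v).toReal with hH
  have hpos : 0 ≤ H := ENNReal.toReal_nonneg
  -- The +1 gives a strict inequality, since a representative is extracted from an infimum; 2^β
  -- accounts for the index shift i = n − 1.
  have key : ∀ n : ℕ, ∃ F, Rep (D.block n v) F ((H + 1) * 2 ^ β * (2 : ℝ) ^ (-β * n)) := by
    intro n
    refine exists_rep_of_linftyNorm_lt (by positivity) ?_
    have h1 : ENNReal.ofReal ((2 : ℝ) ^ (β * ((n : ℝ) - 1))) * linftyNorm (D.block n v)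
        ≤ ENNReal.ofReal H := by
      rw [hH, ENNReal.ofReal_toReal (ne_of_lt h)]
      exact le_iSup (fun n : ℕ => ENNReal.ofReal ((2 : ℝ) ^ (β * ((n : ℝ) - 1))) *
        linftyNorm (D.block n v)) n
    have h2 : ENNReal.ofReal H < ENNReal.ofReal (H + 1) :=
      (ENNReal.ofReal_lt_ofReal_iff (by positivity)).2 (by linarith)
    have h3 : H + 1 = (2 : ℝ) ^ (β * ((n : ℝ) - 1)) * ((H + 1) * 2 ^ β * (2 : ℝ) ^ (-β * n)) := by
      have : (2 : ℝ) ^ (β * ((n : ℝ) - 1)) * (2 ^ β * (2 : ℝ) ^ (-β * n)) = 1 := by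
        rw [← Real.rpow_add two_pos, ← Real.rpow_add two_pos]
        ring_nf
        exact Real.rpow_zero 2
      linear_combination (-(H + 1)) * this
    have h4 := h1.trans_lt h2
    rw [h3, ENNReal.ofReal_mul (by positivity)] at h4
    exact lt_of_mul_lt_mul_left' h4
  choose G hG using key
  exact ⟨_, G, by positivity, hG⟩

theorem rep_paraTerm {a : Rd d → ℂ} (ha : MemLp a ∞ volume) {v : 𝓢'(Rd d, ℂ)} {n : ℕ}
    {F : Rd d → ℂ} {B : ℝ} (hv : Rep (D.block n v) F B) :
    Rep (D.paraTerm (distOf a ha) v n) (fun x => conv (D.lowKernel n) a x * F x)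
      ((∫ y, ‖D.lowKernel n y‖) * (eLpNorm a ∞ volume).toReal * B) := by
  rw [paraTerm_distOf]
  have hb := essBdd_of_memLp ha
  exact hv.smulLeft (hasTemperateGrowth_conv hb _) (hb.conv _)

theorem _root_.Paracontrolled.Rep.block {u : 𝓢'(Rd d, ℂ)} {F : Rd d → ℂ} {B : ℝ} (hu : Rep u F B)
    (n : ℕ) : Rep (D.block n u) (conv (D.kernel n) F) ((∫ y, ‖D.kernel n y‖) * B) :=
  hu.multiplier (D.rhoSchwartz n)

theorem exists_rep_paraTerm {β : ℝ} {a : Rd d → ℂ} (ha : MemLp a ∞ volume) {v : 𝓢'(Rd d, ℂ)}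
    {C : ℝ} {G : ℕ → Rd d → ℂ} (hC : 0 ≤ C) (hv : D.BlockBound β v C G) :
    ∃ C', 0 ≤ C' ∧ ∀ n : ℕ, Rep (D.paraTerm (distOf a ha) v n)
      (fun x => conv (D.lowKernel n) a x * G n x) (C' * (2 : ℝ) ^ (-β * n)) := by
  obtain ⟨M, hM, h⟩ := D.exists_integral_lowKernel_le
  have h0 : 0 ≤ (eLpNorm a ∞ volume).toReal := ENNReal.toReal_nonneg
  refine ⟨M * (eLpNorm a ∞ volume).toReal * C, by positivity,
    fun n => (D.rep_paraTerm ha (hv n)).mono ?_⟩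
  rw [mul_assoc _ C]
  gcongr
  exact h n

theorem summable_paraTerm {β : ℝ} {a : Rd d → ℂ} (ha : MemLp a ∞ volume) {v : 𝓢'(Rd d, ℂ)}
    {C : ℝ} {G : ℕ → Rd d → ℂ} (hC : 0 ≤ C) (hv : D.BlockBound β v C G) :
    D.ParaConverges (distOf a ha) v := by
  obtain ⟨B, hB, hrep⟩ := D.exists_rep_paraTerm ha hC hv
  -- The decay 2^{-2nM} must beat the possible growth 2^{|β|n} and leave a factor 2^{-n}.
  obtain ⟨M, hM⟩ := exists_nat_ge (|β| + 1)
  obtain ⟨C₁, hC₁, hdecay⟩ := D.exists_norm_block_apply_le M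
  -- After a shift by 5 every index in the window is at least n + 1, which avoids the block at the
  -- origin, where there is no decay.
  rw [ParaConverges, ← summable_nat_add_iff 5]
  refine summable_of_norm_apply_le (powLaplacian M) (B := 9 * (C₁ * (B * 2 ^ (5 * |β|)))) ?_
  intro n φ
  set I := ∫ x, ‖powLaplacian M φ x‖ with hI
  have hI0 : 0 ≤ I := integral_nonneg fun x => norm_nonneg _
  have hexp : (2 : ℝ) ^ (-β * ((n + 5 : ℕ) : ℝ)) * ((((2 : ℝ) ^ n)⁻¹ ^ 2) ^ M)
      ≤ 2 ^ (5 * |β|) * (1 / 2) ^ n := by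
    have e1 : (((2 : ℝ) ^ n)⁻¹ ^ 2) ^ M = 2 ^ (-(2 * n * M : ℝ)) := by
      rw [← pow_mul, inv_pow, ← pow_mul, Real.rpow_neg two_pos.le, ← Real.rpow_natCast]
      push_cast
      ring_nf
    have e2 : (1 / 2 : ℝ) ^ n = 2 ^ (-(n : ℝ)) := by
      rw [one_div, inv_pow, Real.rpow_neg two_pos.le, Real.rpow_natCast]
    rw [e1, e2, ← Real.rpow_add two_pos, ← Real.rpow_add two_pos]
    refine Real.rpow_le_rpow_of_exponent_le one_le_two ?_
    push_cast
    have hn : (0 : ℝ) ≤ n := Nat.cast_nonneg n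
    have h1 := neg_abs_le β
    have h2 : (|β| + 1) * n ≤ M * n := by gcongr
    have h3 : 0 ≤ (β + |β|) * n := mul_nonneg (by linarith) hn
    have h4 : 0 ≤ (M : ℝ) * n := by positivity
    nlinarith
  have hterm : ∀ m ∈ window (n + 5), ‖D.block m (D.paraTerm (distOf a ha) v (n + 5)) φ‖
      ≤ (C₁ * (B * 2 ^ (5 * |β|))) * (1 / 2) ^ n * I := by
    intro m hm
    rw [mem_window] at hm
    obtain ⟨m, rfl⟩ : ∃ m', m = m' + 1 := ⟨m - 1, by omega⟩
    refine (hdecay m (hrep (n + 5)) φ).trans ?_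
    have hmn : (((2 : ℝ) ^ m)⁻¹ ^ 2) ^ M ≤ (((2 : ℝ) ^ n)⁻¹ ^ 2) ^ M := by
      gcongr
      · exact one_le_two
      · omega
    calc _ ≤ (((2 : ℝ) ^ n)⁻¹ ^ 2) ^ M * (C₁ * (B * 2 ^ (-β * ((n + 5 : ℕ) : ℝ))) * I) := by gcongr
      _ = C₁ * B * I * (2 ^ (-β * ((n + 5 : ℕ) : ℝ)) * (((2 : ℝ) ^ n)⁻¹ ^ 2) ^ M) := by ring
      _ ≤ C₁ * B * I * (2 ^ (5 * |β|) * (1 / 2) ^ n) := by gcongr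
      _ = _ := by ring
  rw [← D.sum_window_block_paraTerm ha v (n + 5), _root_.sum_apply]
  refine (norm_sum_le _ _).trans ((Finset.sum_le_sum hterm).trans (le_of_eq ?_))
  have hcard : (window (n + 5)).card = 9 := by
    rw [window, Nat.card_Icc]
    omega
  rw [Finset.sum_const, hcard, nsmul_eq_mul]
  push_cast
  ring

theorem block_para {a : Rd d → ℂ} (ha : MemLp a ∞ volume) {v : 𝓢'(Rd d, ℂ)}
    (h : D.ParaConverges (distOf a ha) v) (m : ℕ) :
    D.block m (D.para (distOf a ha) v)
      = ∑ n ∈ window m, D.block m (D.paraTerm (distOf a ha) v n) := by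
  rw [para, (D.block m).map_tsum h]
  exact tsum_eq_sum fun n hn => D.block_paraTerm_eq_zero ha v hn

/-- A paraproduct with a bounded function preserves the regularity β, so paraproducts can be
iterated; the explicit blocks are what the remainder estimate expands. -/
theorem rep_block_para {a : Rd d → ℂ} (ha : MemLp a ∞ volume) {v : 𝓢'(Rd d, ℂ)} {β C : ℝ}
    {G : ℕ → Rd d → ℂ} (hC : 0 ≤ C) (hv : D.BlockBound β v C G) :
    ∃ C', 0 ≤ C' ∧ D.BlockBound β (D.para (distOf a ha) v) C'
      (fun m x => ∑ n ∈ window m, conv (D.kernel m) (fun z => conv (D.lowKernel n) a z * G n z) x) := by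
  obtain ⟨B, hB, hrep⟩ := D.exists_rep_paraTerm ha hC hv
  obtain ⟨M, hM, hker⟩ := D.exists_integral_kernel_le
  refine ⟨9 * (M * (B * 2 ^ (4 * |β|))), by positivity, fun m => ?_⟩
  rw [D.block_para ha (D.summable_paraTerm ha hC hv)]
  refine (Rep.sum (window m) fun n _ => (hrep n).block D m).mono ?_
  have h1 : ∀ n ∈ window m, (∫ y, ‖D.kernel m y‖) * (B * (2 : ℝ) ^ (-β * n))
      ≤ M * (B * (2 ^ (4 * |β|) * 2 ^ (-β * m))) := fun n hn => by
    gcongr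
    · exact hker m
    · exact rpow_neg_mul_le_of_mem_window β hn
  have h2 := card_window_le m
  refine (Finset.sum_le_sum h1).trans ?_
  rw [Finset.sum_const, nsmul_eq_mul]
  calc _ ≤ 9 * (M * (B * (2 ^ (4 * |β|) * (2 : ℝ) ^ (-β * m)))) := by gcongr
    _ = _ := by ring

end DyadicPartition

/-! ### The remainder estimate -/

theorem norm_le_of_twoParamHolderNorm {α : ℝ} (hα : 0 < α) {F : Rd d → Rd d → ℂ}
    (h : twoParamHolderNorm α F < ∞) (y z : Rd d) :
    ‖F y z‖ ≤ (twoParamHolderNorm α F).toReal * ‖y - z‖ ^ α := by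
  have h1 : ‖F y z‖ₑ / ‖y - z‖ₑ ^ α ≤ twoParamHolderNorm α F :=
    le_iSup₂ (f := fun y z => ‖F y z‖ₑ / ‖y - z‖ₑ ^ α) y z
  rw [ENNReal.div_le_iff_le_mul (Or.inr h.ne)
    (Or.inl (ENNReal.rpow_ne_top_of_nonneg hα.le enorm_ne_top))] at h1
  have h2 := ENNReal.toReal_mono
    (ENNReal.mul_ne_top h.ne (ENNReal.rpow_ne_top_of_nonneg hα.le enorm_ne_top)) h1
  rwa [ENNReal.toReal_mul, ← ENNReal.toReal_rpow, toReal_enorm, toReal_enorm] at h2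

theorem moment_le_of_le {α l l' c : ℝ} (hα : 0 ≤ α) (hl : 0 ≤ l) (hl' : 0 ≤ l') (hc : 1 ≤ c)
    (h : l ≤ c * l') (K : 𝓢(Rd d, ℂ)) : moment α l K ≤ c ^ α * moment α l' K := by
  rw [moment, moment, ← integral_const_mul]
  refine integral_mono (integrable_moment hα hl K) ((integrable_moment hα hl' K).const_mul _) ?_
  intro z
  have h1 : (1 + l * ‖z‖) ^ α ≤ c ^ α * (1 + l' * ‖z‖) ^ α := by
    rw [← Real.mul_rpow (by positivity) (by positivity)]
    refine Real.rpow_le_rpow (by positivity) ?_ hα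
    nlinarith [mul_le_mul_of_nonneg_right h (norm_nonneg z)]
  calc ‖K z‖ * (1 + l * ‖z‖) ^ α ≤ ‖K z‖ * (c ^ α * (1 + l' * ‖z‖) ^ α) := by gcongr
    _ = _ := by ring

/-- The elementary bound behind the cancellation in `∑ R°(aₙ, bₙ, g)`: at a point `x`, the product of
averages of `aₙ` and `bₙ` on a scale `l⁻¹` is a linear expression in `f`, `aₙ bₙ` up to an average of
`fsharp`. -/
theorem norm_average_remainder_le {α l : ℝ} (hα : 0 ≤ α) (hl : 0 < l) {N : ℕ}
    {f : Rd d → ℂ} {a b : Fin N → Rd d → ℂ} {fsharp : Rd d → Rd d → ℂ} {Cf : ℝ} {Ca Cb : Fin N → ℝ}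
    (hf : EssBdd f Cf) (ha : ∀ n, EssBdd (a n) (Ca n)) (hb : ∀ n, EssBdd (b n) (Cb n))
    (hfab : ∀ x y, f y - f x = (∑ n, a n x * (b n y - b n x)) + fsharp y x)
    {H : ℝ} (hH : 0 ≤ H) (hsharp : ∀ y z, ‖fsharp y z‖ ≤ H * ‖y - z‖ ^ α)
    {G : Rd d → ℂ} {Cg : ℝ} (hG : EssBdd G Cg) {K₁ K₂ K₃ : 𝓢(Rd d, ℂ)}
    (hK₁ : ∫ y, K₁ y = 1) (hK₃ : ∫ y, K₃ y = 1) (x : Rd d) :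
    ‖(∑ n, conv K₁ (a n) x * conv K₂ (fun z => conv K₃ (b n) z * G z) x)
        - (∑ n, conv K₁ (fun y => a n y * b n y) x * conv K₂ G x)
        - conv K₂ (fun z => conv K₃ f z * G z) x + conv K₁ f x * conv K₂ G x‖
      ≤ H * (l ^ (-α) * (moment α l K₃ * (Cg * (moment α l K₂ * moment α l K₁)))) := by
  have hCg := hG.nonneg
  set A : (Rd d → ℂ) → ℂ := fun h => conv K₂ (fun z => conv K₃ h z * G z) x with hA
  set A₁ : ℂ := conv K₂ G x with hA₁
  have hfs : ∀ w y, fsharp w y = f w - f y - ∑ n, a n y * (b n w - b n y) := fun w y => by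
    rw [hfab y w]
    ring
  have hc3 : ∀ (c : ℂ) z, conv K₃ (fun _ => c) z = c := fun c z => by rw [conv_const, hK₃, mul_one]
  -- For frozen y, f♯ is a combination of f, the b_n and constants. As K₃ has integral 1, `A` sends
  -- a constant c to c times `A₁`.
  have lin : ∀ y, A (fun w => fsharp w y)
      = A f - f y * A₁ - ∑ n, (a n y * A (b n) - a n y * b n y * A₁) := by
    intro y
    have e1 : ∀ z, conv K₃ (fun w => fsharp w y) z
        = conv K₃ f z - f y - ∑ n, a n y * (conv K₃ (b n) z - b n y) := by
      intro z
      have hsum : ∀ n ∈ Finset.univ, EssBdd (fun w => a n y * (b n w - b n y))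
          (‖a n y‖ * (Cb n + ‖b n y‖)) :=
        fun n _ => ((hb n).sub (essBdd_const _)).const_mul _
      simp only [hfs]
      rw [conv_sub (hf.sub (essBdd_const _)) (EssBdd.sum _ hsum), conv_sub hf (essBdd_const _),
        conv_sum _ hsum, hc3]
      congr 1
      refine Finset.sum_congr rfl fun n _ => ?_
      rw [conv_const_mul, conv_sub (hb n) (essBdd_const _), hc3]
    have e2 : ∀ z, conv K₃ (fun w => fsharp w y) z * G z
        = conv K₃ f z * G z - f y * G z
          - ∑ n, (a n y * (conv K₃ (b n) z * G z) - a n y * b n y * G z) := by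
      intro z
      rw [e1, sub_mul, sub_mul, Finset.sum_mul]
      congr 1
      exact Finset.sum_congr rfl fun n _ => by ring
    have hsum : ∀ n ∈ Finset.univ, EssBdd
        (fun z => a n y * (conv K₃ (b n) z * G z) - a n y * b n y * G z) _ :=
      fun n _ => ((((hb n).conv K₃).mul hG).const_mul (a n y)).sub (hG.const_mul (a n y * b n y))
    simp only [hA, e2]
    rw [conv_sub ((((hf.conv K₃).mul hG)).sub (hG.const_mul _)) (EssBdd.sum _ hsum),
      conv_sub ((hf.conv K₃).mul hG) (hG.const_mul _), conv_sum _ hsum, conv_const_mul]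
    congr 1
    refine Finset.sum_congr rfl fun n _ => ?_
    rw [conv_sub ((((hb n).conv K₃).mul hG).const_mul (a n y)) (hG.const_mul (a n y * b n y)),
      conv_const_mul, conv_const_mul]
  -- Averaging in y against K₁ freezes A(f) and A(b_n), which do not depend on y, and turns a_n, a_n
  -- b_n and f into their K₁-averages.
  have outer : conv K₁ (fun y => A (fun w => fsharp w y)) x
      = A f - conv K₁ f x * A₁
        - ∑ n, (conv K₁ (a n) x * A (b n) - conv K₁ (fun y => a n y * b n y) x * A₁) := by
    have h1 : ∀ n, EssBdd (fun y => a n y * A (b n)) _ := fun n => (ha n).mul (essBdd_const _)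
    have h2 : ∀ n, EssBdd (fun y => a n y * b n y * A₁) _ :=
      fun n => ((ha n).mul (hb n)).mul (essBdd_const _)
    have hsum : ∀ n ∈ Finset.univ, EssBdd (fun y => a n y * A (b n) - a n y * b n y * A₁) _ :=
      fun n _ => (h1 n).sub (h2 n)
    simp only [lin]
    rw [conv_sub ((essBdd_const (A f)).sub (hf.mul (essBdd_const A₁))) (EssBdd.sum _ hsum),
      conv_sub (essBdd_const (A f)) (hf.mul (essBdd_const A₁)), conv_sum _ hsum, conv_const, hK₁,
      mul_one, conv_mul_const]
    congr 1
    refine Finset.sum_congr rfl fun n _ => ?_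
    rw [conv_sub (h1 n) (h2 n), conv_mul_const, conv_mul_const]
  have hfinal : (∑ n, conv K₁ (a n) x * A (b n))
        - (∑ n, conv K₁ (fun y => a n y * b n y) x * A₁) - A f + conv K₁ f x * A₁
      = -conv K₁ (fun y => A (fun w => fsharp w y)) x := by
    rw [outer, Finset.sum_sub_distrib]
    ring
  rw [hfinal, norm_neg]
  have m1 := moment_nonneg (α := α) hl.le K₁
  have m2 := moment_nonneg (α := α) hl.le K₂
  have m3 := moment_nonneg (α := α) hl.le K₃
  -- The power |w−y|^α is traded for a submultiplicative weight, which passes through the three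
  -- averages one at a time.
  have b0 : ∀ w y, ‖fsharp w y‖ ≤ H * l ^ (-α) * (1 + l * ‖w - y‖) ^ α := by
    intro w y
    refine (hsharp w y).trans ?_
    rw [mul_assoc]
    gcongr
    rw [Real.rpow_neg hl.le, le_inv_mul_iff₀ (by positivity), ← Real.mul_rpow hl.le (norm_nonneg _)]
    exact Real.rpow_le_rpow (by positivity) (by linarith) hα
  have b1 : ∀ z y, ‖conv K₃ (fun w => fsharp w y) z‖
      ≤ H * l ^ (-α) * moment α l K₃ * (1 + l * ‖z - y‖) ^ α := fun z y =>
    norm_conv_le_weight hα hl.le (by positivity) (Filter.Eventually.of_forall fun w => b0 w y) K₃ z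
  have b2 : ∀ y, ‖A (fun w => fsharp w y)‖
      ≤ H * l ^ (-α) * moment α l K₃ * Cg * moment α l K₂ * (1 + l * ‖x - y‖) ^ α := by
    intro y
    refine norm_conv_le_weight hα hl.le (by positivity) ?_ K₂ x
    filter_upwards [hG.bound] with z hz
    rw [norm_mul]
    calc _ ≤ H * l ^ (-α) * moment α l K₃ * (1 + l * ‖z - y‖) ^ α * Cg := by
          gcongr
          exact b1 z y
      _ = _ := by ring
  -- Centred at the evaluation point x itself, the remaining weight equals 1.
  have b3 := norm_conv_le_weight (y := x) (F := fun y => A (fun w => fsharp w y)) hα hl.le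
    (B := H * l ^ (-α) * moment α l K₃ * Cg * moment α l K₂) (by positivity)
    (Filter.Eventually.of_forall fun y => by rw [norm_sub_rev y x]; exact b2 y) K₁ x
  refine b3.trans (le_of_eq ?_)
  simp
  ring

/-! ### Remainder bounds on dyadic blocks -/

namespace DyadicPartition

variable (D : DyadicPartition d)

theorem exists_moment_window_le {α : ℝ} (hα : 0 ≤ α) : ∃ M : ℝ, 0 ≤ M ∧ ∀ k, 6 ≤ k →
    moment α (2 ^ k) (D.kernel k) ≤ M ∧ ∀ j ∈ window k, moment α (2 ^ k) (D.lowKernel j) ≤ M := by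
  obtain ⟨M₁, hM₁, h₁⟩ := D.exists_moment_kernel_le α
  obtain ⟨M₂, hM₂, h₂⟩ := D.exists_moment_lowKernel_le α
  -- The low kernel of index j has natural scale 2^{j−2}, and k ≤ j + 4, so the scales differ by at
  -- most 2^6 = 64.
  refine ⟨64 ^ α * (M₁ + M₂), by positivity, fun k hk => ⟨?_, fun j hj => ?_⟩⟩
  · obtain ⟨k, rfl⟩ : ∃ k', k = k' + 1 := ⟨k - 1, by omega⟩
    refine (moment_le_of_le (l' := 2 ^ k) (c := 64) hα (by positivity) (by positivity) (by norm_num)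
      ?_ _).trans ?_
    · rw [pow_succ]
      linarith [show (0 : ℝ) ≤ 2 ^ k by positivity]
    · gcongr
      linarith [h₁ k]
  · rw [mem_window] at hj
    obtain ⟨j, rfl⟩ : ∃ j', j = j' + 2 := ⟨j - 2, by omega⟩
    refine (moment_le_of_le (l' := 2 ^ j) (c := 64) hα (by positivity) (by positivity) (by norm_num)
      ?_ _).trans ?_
    · have h3 : (2 : ℝ) ^ k ≤ 2 ^ (j + 6) := pow_le_pow_right₀ one_le_two (by omega)
      rw [pow_add] at h3
      linarith
    · gcongr
      linarith [h₂ j]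

/-- Finitely many blocks affect the supremum only through their finiteness, so the rate is needed at
high frequencies alone. -/
theorem memHolder_of_rep {γ : ℝ} {u : 𝓢'(Rd d, ℂ)} (hfin : ∀ m, linftyNorm (D.block m u) < ∞)
    {m₀ : ℕ} {B : ℝ} (h : ∀ m, m₀ ≤ m → ∃ F, Rep (D.block m u) F (B * (2 : ℝ) ^ (-γ * m))) :
    D.MemHolder γ u := by
  set t : ℕ → ℝ≥0∞ := fun m =>
    ENNReal.ofReal ((2 : ℝ) ^ (γ * ((m : ℝ) - 1))) * linftyNorm (D.block m u) with ht
  have ht_fin : ∀ m, t m < ∞ := fun m => ENNReal.mul_lt_top ENNReal.ofReal_lt_top (hfin m)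
  have hle : ∀ m, t m ≤ ∑ i ∈ Finset.range m₀, t i + ENNReal.ofReal (B * 2 ^ (-γ)) := by
    intro m
    by_cases hm : m < m₀
    · exact (Finset.single_le_sum (fun i _ => zero_le) (Finset.mem_range.2 hm)).trans le_self_add
    · obtain ⟨F, hF⟩ := h m (not_lt.1 hm)
      refine le_trans ?_ le_add_self
      calc t m ≤ ENNReal.ofReal ((2 : ℝ) ^ (γ * ((m : ℝ) - 1))) *
              ENNReal.ofReal (B * (2 : ℝ) ^ (-γ * m)) := by
            simp only [ht]
            gcongr
            exact hF.linftyNorm_le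
        _ = ENNReal.ofReal (B * 2 ^ (-γ)) := by
            rw [← ENNReal.ofReal_mul (by positivity), mul_left_comm, ← Real.rpow_add two_pos]
            ring_nf
  refine (iSup_le hle).trans_lt (ENNReal.add_lt_top.2 ⟨?_, ENNReal.ofReal_lt_top⟩)
  exact ENNReal.sum_lt_top.2 fun i _ => ht_fin i

theorem exists_rep_remainder {α β : ℝ} (hα : 0 < α) {f : Rd d → ℂ} (hf : MemLp f ∞ volume)
    {N : ℕ} {a b : Fin N → Rd d → ℂ} (ha : ∀ n, MemLp (a n) ∞ volume)
    (hb : ∀ n, MemLp (b n) ∞ volume) {fsharp : Rd d → Rd d → ℂ}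
    (hsharp : twoParamHolderNorm α fsharp < ∞)
    (hfab : ∀ x y, f y - f x = (∑ n, a n x * (b n y - b n x)) + fsharp y x)
    {g : 𝓢'(Rd d, ℂ)} {C : ℝ} {G : ℕ → Rd d → ℂ} (hC : 0 ≤ C) (hg : D.BlockBound β g C G) :
    ∃ B, 0 ≤ B ∧ ∀ k, 6 ≤ k → ∃ F, Rep
      ((∑ n, D.paraTerm (distOf (a n) (ha n)) (D.para (distOf (b n) (hb n)) g) k)
        - (∑ n, D.paraTerm (distOf _ (memLp_top_mul (ha n) (hb n))) g k)
        - D.block k (D.para (distOf f hf) g) + D.paraTerm (distOf f hf) g k)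
      F (B * (2 : ℝ) ^ (-(α + β) * k)) := by
  obtain ⟨M, hM, hmom⟩ := D.exists_moment_window_le hα.le
  set H := (twoParamHolderNorm α fsharp).toReal with hH
  have hH0 : 0 ≤ H := ENNReal.toReal_nonneg
  have hs := norm_le_of_twoParamHolderNorm hα hsharp
  refine ⟨9 * (H * (M * (C * 2 ^ (4 * |β|) * (M * M)))), by positivity, fun k hk => ?_⟩
  choose Cb hCb hPb using fun n => D.rep_block_para (hb n) hC hg
  obtain ⟨Cf, hCf, hPf⟩ := D.rep_block_para hf hC hg
  have hgk := Rep.sum (window k) fun j _ => (hg j).block D k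
  rw [D.sum_window_block_block k g] at hgk
  have hrep := (((Rep.sum Finset.univ fun n _ => D.rep_paraTerm (ha n) (hPb n k)).sub
    (Rep.sum Finset.univ fun n _ => D.rep_paraTerm (memLp_top_mul (ha n) (hb n)) hgk)).sub
    (hPf k)).add (D.rep_paraTerm hf hgk)
  -- The constant in `hrep` only comes from the triangle inequality; the factor 2^{-αk} comes from a
  -- pointwise bound on the representative.
  refine ⟨_, hrep.of_bound fun x => ?_⟩
  have hk2 : ∀ j ∈ window k, ∫ y, D.lowKernel j y = 1 := fun j hj => by
    rw [mem_window] at hj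
    obtain ⟨j, rfl⟩ : ∃ j', j = j' + 2 := ⟨j - 2, by omega⟩
    exact D.integral_lowKernel j
  have hkk : k ∈ window k := mem_window.2 ⟨by omega, by omega⟩
  have hbound : ∀ j ∈ window k, _ := fun j hj =>
    norm_average_remainder_le (l := 2 ^ k) (K₁ := D.lowKernel k) (K₂ := D.kernel k)
      (K₃ := D.lowKernel j) hα.le (by positivity) (essBdd_of_memLp hf)
      (fun n => essBdd_of_memLp (ha n)) (fun n => essBdd_of_memLp (hb n)) hfab hH0 hs
      (hg j).essBdd (hk2 k hkk) (hk2 j hj) x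
  have hfun : (∑ n, conv (D.lowKernel k) (a n) x *
        ∑ j ∈ window k, conv (D.kernel k) (fun z => conv (D.lowKernel j) (b n) z * G j z) x)
      - (∑ n, conv (D.lowKernel k) (fun y => a n y * b n y) x *
        ∑ j ∈ window k, conv (D.kernel k) (G j) x)
      - (∑ j ∈ window k, conv (D.kernel k) (fun z => conv (D.lowKernel j) f z * G j z) x)
      + conv (D.lowKernel k) f x * ∑ j ∈ window k, conv (D.kernel k) (G j) x
      = ∑ j ∈ window k, ((∑ n, conv (D.lowKernel k) (a n) x *
          conv (D.kernel k) (fun z => conv (D.lowKernel j) (b n) z * G j z) x)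
        - (∑ n, conv (D.lowKernel k) (fun y => a n y * b n y) x * conv (D.kernel k) (G j) x)
        - conv (D.kernel k) (fun z => conv (D.lowKernel j) f z * G j z) x
        + conv (D.lowKernel k) f x * conv (D.kernel k) (G j) x) := by
    simp only [Finset.mul_sum, Finset.sum_add_distrib, Finset.sum_sub_distrib]
    rw [Finset.sum_comm (s := Finset.univ), Finset.sum_comm (s := Finset.univ)]
  rw [hfun]
  have hj : ∀ j ∈ window k, H * ((2 ^ k) ^ (-α) * (moment α (2 ^ k) (D.lowKernel j) *
      (C * (2 : ℝ) ^ (-β * j) * (moment α (2 ^ k) (D.kernel k) *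
        moment α (2 ^ k) (D.lowKernel k)))))
      ≤ H * ((2 ^ k) ^ (-α) * (M * (C * (2 ^ (4 * |β|) * 2 ^ (-β * k)) * (M * M)))) := by
    intro j hj
    have n1 := moment_nonneg (α := α) (l := 2 ^ k) (by positivity) (D.kernel k)
    have n2 := moment_nonneg (α := α) (l := 2 ^ k) (by positivity) (D.lowKernel k)
    have n3 := moment_nonneg (α := α) (l := 2 ^ k) (by positivity) (D.lowKernel j)
    gcongr
    · exact (hmom k hk).2 j hj
    · exact rpow_neg_mul_le_of_mem_window β hj
    · exact (hmom k hk).1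
    · exact (hmom k hk).2 k hkk
  refine (norm_sum_le _ _).trans ((Finset.sum_le_sum fun j hj' =>
    (hbound j hj').trans (hj j hj')).trans ?_)
  have hpow : ((2 : ℝ) ^ k) ^ (-α) * 2 ^ (-β * k) = 2 ^ (-(α + β) * k) := by
    rw [← Real.rpow_natCast, ← Real.rpow_mul two_pos.le, ← Real.rpow_add two_pos]
    ring_nf
  rw [Finset.sum_const, nsmul_eq_mul, ← hpow]
  calc _ ≤ 9 * (H * ((2 ^ k) ^ (-α) * (M * (C * (2 ^ (4 * |β|) * 2 ^ (-β * k)) * (M * M))))) := by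
        gcongr
        exact card_window_le k
    _ = _ := by ring

end DyadicPartition

end Paracontrolled

end

/-! ### Assembly of the blocks -/

open Paracontrolled in
theorem mainTheorem5 {d : ℕ} (D : Paracontrolled.DyadicPartition d) (α : ℝ) (hα : 0 < α)
    (f : Paracontrolled.Rd d → ℂ) (hf : MemLp f ∞ volume)
    (N : ℕ) (a b : Fin N → Paracontrolled.Rd d → ℂ)
    (ha : ∀ n, MemLp (a n) ∞ volume) (hb : ∀ n, MemLp (b n) ∞ volume)
    (fsharp : Paracontrolled.Rd d → Paracontrolled.Rd d → ℂ)
    (hsharp : Paracontrolled.twoParamHolderNorm α fsharp < ∞)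
    (hfab : ∀ x y, f y - f x = (∑ n, a n x * (b n y - b n x)) + fsharp y x)
    (β : ℝ) (g : 𝓢'(Paracontrolled.Rd d, ℂ)) (hg : D.MemHolder β g) :
    (∀ n, D.RcircConverges (a n) (b n) (ha n) (hb n) g) ∧
      D.MemHolder (α + β) (∑ n, D.Rcirc (a n) (b n) (ha n) (hb n) g) := by
  obtain ⟨C, G, hC, hG⟩ := D.exists_blockBound_of_memHolder hg
  choose Cb hCb hPb using fun n => D.rep_block_para (hb n) hC hG
  have hconv : ∀ n, D.RcircConverges (a n) (b n) (ha n) (hb n) g := fun n =>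
    ⟨D.summable_paraTerm (hb n) hC hG, D.summable_paraTerm (ha n) (hCb n) (hPb n),
      D.summable_paraTerm _ hC hG⟩
  refine ⟨hconv, ?_⟩
  choose Ca hCa hPa using fun n => D.rep_block_para (ha n) (hCb n) (hPb n)
  choose Cab hCab hPab using fun n => D.rep_block_para (memLp_top_mul (ha n) (hb n)) hC hG
  have hblock : ∀ m, D.block m (∑ n, D.Rcirc (a n) (b n) (ha n) (hb n) g)
      = ∑ n, (D.block m (D.para (distOf (a n) (ha n)) (D.para (distOf (b n) (hb n)) g))
        - D.block m (D.para (distOf _ (memLp_top_mul (ha n) (hb n))) g)) := fun m => by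
    rw [map_sum]
    exact Finset.sum_congr rfl fun n _ => map_sub _ _ _
  obtain ⟨B, hB, hrem⟩ := D.exists_rep_remainder hα hf ha hb hsharp hfab hC hG
  obtain ⟨M, hM, hker⟩ := D.exists_integral_kernel_le
  -- Two windows of width 4 are crossed: m ≥ 10 forces k ≥ 6 and then j ≥ 2, so that the low kernels
  -- involved have integral 1.
  refine D.memHolder_of_rep (m₀ := 10) (B := 9 * (M * (B * 2 ^ (4 * |α + β|)))) (fun m => ?_)
    (fun m hm => ?_)
  · rw [hblock]
    exact (Rep.sum Finset.univ fun n _ =>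
      (hPa n m).sub (hPab n m)).linftyNorm_le.trans_lt ENNReal.ofReal_lt_top
  · have hk6 : ∀ k ∈ window m, 6 ≤ k := fun k hk => by
      rw [mem_window] at hk
      omega
    choose! F hF using hrem
    -- The two inserted terms cancel: summed over the window, the m-th blocks of Δ_k P_f g and of
    -- S_k f · Δ_k g both give the m-th block of P_f g.
    have hid : D.block m (∑ n, D.Rcirc (a n) (b n) (ha n) (hb n) g) = ∑ k ∈ window m, D.block m
        ((∑ n, D.paraTerm (distOf (a n) (ha n)) (D.para (distOf (b n) (hb n)) g) k)
        - (∑ n, D.paraTerm (distOf _ (memLp_top_mul (ha n) (hb n))) g k)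
        - D.block k (D.para (distOf f hf) g) + D.paraTerm (distOf f hf) g k) := by
      rw [hblock]
      simp only [map_add, map_sub, map_sum, Finset.sum_add_distrib, Finset.sum_sub_distrib]
      rw [← D.block_para hf (D.summable_paraTerm hf hC hG),
        D.sum_window_block_block m (D.para (distOf f hf) g), sub_add_cancel,
        Finset.sum_comm (s := window m), Finset.sum_comm (s := window m)]
      congr 1
      · exact Finset.sum_congr rfl fun n _ => D.block_para _ (hconv n).2.1 m
      · exact Finset.sum_congr rfl fun n _ => D.block_para _ (hconv n).2.2 m
    rw [hid]
    refine ⟨_, (Rep.sum (window m) fun k hk => (hF k (hk6 k hk)).block D m).mono ?_⟩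
    have h1 : ∀ k ∈ window m, (∫ y, ‖D.kernel m y‖) * (B * (2 : ℝ) ^ (-(α + β) * k))
        ≤ M * (B * (2 ^ (4 * |α + β|) * 2 ^ (-(α + β) * m))) := fun k hk => by
      gcongr
      · exact hker m
      · exact rpow_neg_mul_le_of_mem_window (α + β) hk
    refine (Finset.sum_le_sum h1).trans ?_
    rw [Finset.sum_const, nsmul_eq_mul]
    calc _ ≤ 9 * (M * (B * (2 ^ (4 * |α + β|) * (2 : ℝ) ^ (-(α + β) * m)))) := by
          gcongr
          exact card_window_le m
      _ = _ := by ring
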